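/- **Definitions.** An *orthomodular poset* is a bounded poset $A$ with an order-reversing involution $'$ such that $a$ and $a'$ have only the lower bound $0$ in common, orthogonal elements ($a\le b'$) have a join, and $b=a\vee(a\vee b')'$ whenever $a\le b$; the one-element poset is allowed. For orthogonal $a,b$ put $a\oplus b=a\vee b$. $\mathbf{OMP}$ is the category of orthomodular posets with the orthoalgebra morphisms, i.e. the maps that preserve $1$ and $\oplus$ (if $a\oplus b$ is defined then so is $f(a)\oplus f(b)$, and it equals $f(a\oplus b)$). A *Boolean subalgebra* of $A$ is a subset containing $0,1$, closed under $'$ and $\oplus$, that is a Boolean algebra in the induced order. A *pre-orthogeometry* is a set of points with a set of lines, each a set of three points, such that any two distinct points lie on at most one line. A *subspace* is a set of points that contains the third point of a line whenever it contains two points of it. A *plane* is a subspace of seven distinct points $a,b,c,d,u,v,w$ such that exactly six lines contain at least two of them, namely $\{a,b,u\},\{c,d,u\},\{a,c,v\},\{b,d,v\},\{a,d,w\},\{b,c,w\}$. An *orthogeometry* is a pre-orthogeometry that is isomorphic to the one whose points and lines are the 4-element and the 8-element Boolean subalgebras of some orthomodular poset, with incidence given by inclusion. A *morphism* of orthogeometries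 is a partial function $\alpha$ between the points (write $\alpha(p)=\bot$ if it is undefined at $p$) such that 1. for each line $\{p,q,r\}$: if $\alpha(p)=\bot$ then $\alpha(q)=\alpha(r)$ (possibly both $\bot$); if $\alpha$ is defined at $p,q,r$, then $\{\alpha(p),\alpha(q),\alpha(r)\}$ is a line; 2. if $\alpha$ is defined at the four points $a,b,c,d$ of a plane that lie on three of its lines, then $\alpha$ maps the plane isomorphically onto a plane; 3. if two lines through $p$ are mapped onto lines, and these span a plane in which they are the only two lines through $\alpha(p)$, then the two given lines span a plane in which they are the only two lines through $p$. $\mathbf{OG}$ is the category of orthogeometries and these morphisms, under composition of partial functions. A morphism $f:A\to A'$ of $\mathbf{OMP}$ is *proper* if each Boolean subalgebra of $A$ with at most 8 elements is contained in a Boolean subalgebra (equivalently, in a block, i.e. a maximal Boolean subalgebra) $B$ of $A$ such that $f[B]$ has more than four elements. Call a set $S$ of points of an orthogeometry *Boolean* if any two distinct points of $S$ lie in a line or plane that is contained in $S$. A morphism $\alpha$ of orthogeometries is *proper* if the empty set, each one-point set and each line is contained in a Boolean set $S$ of points such that $\alpha[S]$ has more than one point. **Theorem.** There is a functor $\mathcal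 G:\mathbf{OMP}\to\mathbf{OG}$ such that, up to isomorphisms $\mathcal G(A)\cong(\text{points},\text{lines})$, the points and lines of $\mathcal G(A)$ are the 4-element and the 8-element Boolean subalgebras of $A$, and for $f:A\to A'$ the partial function $\mathcal G(f)$ takes a point $p$ to $f[p]$ if $f[p]$ is a 4-element Boolean subalgebra and is undefined at $p$ otherwise. Moreover: * $\mathcal G$ is essentially surjective on objects; * $\mathcal G$ is injective on isomorphism classes of objects, with the exception of the orthomodular posets with one or two elements: $\mathcal G(A)\cong\mathcal G(A')$ if and only if $A\cong A'$ or both $A$ and $A'$ have at most two elements; * $\mathcal G$ is full and faithful with respect to proper morphisms: for all $A,A'$, the assignment $f\mapsto\mathcal G(f)$ restricts to a bijection from the proper morphisms $A\to A'$ onto the proper morphisms $\mathcal G(A)\to\mathcal G(A')$. -/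

import Mathlib

open CategoryTheory

universe u

/-! ## Orthomodular posets and their category -/

/-- An orthomodular poset: a bounded poset with an orthocomplementation, in which any two
orthogonal elements have a join and in which `b = a ∨ (a ∨ bᶜ)ᶜ` whenever `a ≤ b`.
The one-element poset (`⊥ = ⊤`) is allowed. -/
class OrthomodularPoset (A : Type u) extends PartialOrder A, BoundedOrder A, Compl A where
  oc_invol : ∀ a : A, aᶜᶜ = a
  oc_antitone : ∀ a b : A, a ≤ b → bᶜ ≤ aᶜ
  oc_disjoint : ∀ a b : A, b ≤ a → b ≤ aᶜ → b = ⊥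
  exists_orthogonal_join : ∀ a b : A, a ≤ bᶜ → ∃ c, IsLUB {a, b} c
  orthomodular_law : ∀ a b : A, a ≤ b → ∀ c, IsLUB {a, bᶜ} c → IsLUB {a, cᶜ} b

/-- `IsOrthosum a b c`: the elements `a` and `b` are orthogonal and `a ⊕ b = c`. This is the
orthoalgebra operation of an orthomodular poset: `a ⊕ b` is defined iff `a ≤ bᶜ`, and then it is
the join of `a` and `b`. -/
def IsOrthosum {A : Type u} [OrthomodularPoset A] (a b c : A) : Prop :=
  a ≤ bᶜ ∧ IsLUB {a, b} c

/-- A bundled orthomodular poset: an object of the category `OMP`. -/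
structure OMP : Type (u + 1) where
  carrier : Type u
  [str : OrthomodularPoset carrier]

namespace OMP

instance : CoeSort OMP.{u} (Type u) := ⟨OMP.carrier⟩

instance (A : OMP.{u}) : OrthomodularPoset A := A.str

/-- Orthoalgebra morphisms: maps that preserve `1` and the partial operation `⊕`
(hence also `0`, the orthocomplement and the order). -/
@[ext]
structure Hom (A B : OMP.{u}) where
  toFun : A → B
  map_top : toFun ⊤ = ⊤
  map_orthosum : ∀ a b c : A, IsOrthosum a b c → IsOrthosum (toFun a) (toFun b) (toFun c)

/-- The category of orthomodular posets and orthoalgebra morphisms. -/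
instance : Category OMP.{u} where
  Hom := Hom
  id A := ⟨fun a => a, rfl, fun _ _ _ h => h⟩
  comp f g := ⟨fun a => g.toFun (f.toFun a), by rw [f.map_top, g.map_top],
    fun a b c h => g.map_orthosum _ _ _ (f.map_orthosum a b c h)⟩

end OMP

/-- A Boolean subalgebra of an orthomodular poset: a subset containing `0` and `1`, closed under
orthocomplements and under `⊕`, which is a Boolean algebra in the induced order (the Boolean
complement is then necessarily the induced orthocomplement). -/
structure IsBooleanSubalgebra {A : Type u} [OrthomodularPoset A] (B : Set A) : Prop where
  bot_mem : ⊥ ∈ B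
  top_mem : ⊤ ∈ B
  compl_mem : ∀ a ∈ B, aᶜ ∈ B
  orthosum_mem : ∀ a ∈ B, ∀ b ∈ B, ∀ c, IsOrthosum a b c → c ∈ B
  boolean : ∃ (X : Type u) (_ : BooleanAlgebra X), Nonempty (X ≃o B)

/-- The 4-element Boolean subalgebras of an orthomodular poset. -/
def FourElementSubalgebra (A : OMP.{u}) : Type u :=
  {B : Set A // IsBooleanSubalgebra B ∧ B.encard = 4}

/-- A morphism `f : A ⟶ A'` is proper if every Boolean subalgebra of `A` with at most 8 elements
is contained in a Boolean subalgebra (equivalently, in a block) of `A` whose image under `f` has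
more than four elements. -/
def OMP.IsProper {A A' : OMP.{u}} (f : A ⟶ A') : Prop :=
  ∀ C : Set A, IsBooleanSubalgebra C → C.encard ≤ 8 →
    ∃ B : Set A, IsBooleanSubalgebra B ∧ C ⊆ B ∧ 4 < (OMP.Hom.toFun f '' B).encard

/-! ## Pre-orthogeometries, their planes, and orthogeometries -/

/-- A pre-orthogeometry: points, and lines that are sets of three points, such that any two
points are contained in at most one line. -/
structure PreOrthogeometry : Type (u + 1) where
  Point : Type u
  lines : Set (Set Point)
  encard_line : ∀ l ∈ lines, l.encard = 3
  line_unique : ∀ l ∈ lines, ∀ m ∈ lines, ∀ p q : Point, p ≠ q →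
    p ∈ l → q ∈ l → p ∈ m → q ∈ m → l = m

namespace PreOrthogeometry

/-- A subspace: with two points of a line it contains the third one. -/
def IsSubspace (G : PreOrthogeometry.{u}) (S : Set G.Point) : Prop :=
  ∀ l ∈ G.lines, ∀ p ∈ l, ∀ q ∈ l, p ≠ q → p ∈ S → q ∈ S → l ⊆ S

/-- A labelled plane: seven distinct points that form a subspace, such that exactly six lines
contain at least two of them, configured as the three sides and the three medians of a triangle.
Here `a b c` are the corners, `d` is the centre, and `u v w` are the midpoints. The roles of
`a b c d` are symmetric: each of them is on three of the six lines, and each of `u v w` on two. -/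
structure IsPlane (G : PreOrthogeometry.{u}) (a b c d u v w : G.Point) : Prop where
  distinct : [a, b, c, d, u, v, w].Nodup
  subspace : G.IsSubspace {a, b, c, d, u, v, w}
  lines_eq : {l | l ∈ G.lines ∧ 2 ≤ (l ∩ {a, b, c, d, u, v, w}).encard} =
    {{a, b, u}, {c, d, u}, {a, c, v}, {b, d, v}, {a, d, w}, {b, c, w}}

/-- The planes of the hypergraph associated with `G`, as sets of points. -/
def planes (G : PreOrthogeometry.{u}) : Set (Set G.Point) :=
  {S | ∃ a b c d u v w, G.IsPlane a b c d u v w ∧ S = {a, b, c, d, u, v, w}}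

/-- A set of points is Boolean if any two distinct points of it lie on a line or in a plane that
is contained in it. In the geometry of an orthomodular poset these are the sets of all points
contained in some Boolean subalgebra. -/
def IsBooleanSet (G : PreOrthogeometry.{u}) (S : Set G.Point) : Prop :=
  ∀ p ∈ S, ∀ q ∈ S, p ≠ q → ∃ t ∈ G.lines ∪ G.planes, p ∈ t ∧ q ∈ t ∧ t ⊆ S

/-- An isomorphism from a pre-orthogeometry to the geometry of an orthomodular poset `A`, whose
points are the 4-element Boolean subalgebras of `A` and whose lines are the 8-element ones (each
given by the set of the points that it contains). -/
structure Representation (G : PreOrthogeometry.{u}) (A : OMP.{u}) where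
  toEquiv : G.Point ≃ FourElementSubalgebra A
  mem_lines_iff : ∀ l : Set G.Point, l ∈ G.lines ↔
    ∃ C : Set A, IsBooleanSubalgebra C ∧ C.encard = 8 ∧ toEquiv '' l = {B | B.1 ⊆ C}

end PreOrthogeometry

/-- Orthogeometries, the objects of the category `OG`: pre-orthogeometries isomorphic to the
geometry of an orthomodular poset. -/
structure OG : Type (u + 1) extends PreOrthogeometry.{u} where
  representable : ∃ A : OMP.{u}, Nonempty (toPreOrthogeometry.Representation A)

namespace OG

/-- A morphism of orthogeometries: a partial function between the points (`none` means
undefined) that is a hypergraph morphism for the associated planes.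

* `map_none`, `map_some`: for a line, if one of its points is sent to `none`, then the other two
  have the same image (a point or `none`); if no point is sent to `none`, the image is a line.
* `map_plane`: for a plane, if none of the four points on three lines of it is sent to `none`,
  then the plane is mapped isomorphically onto a plane.
* `reflect_plane`: if two lines through `p` are mapped onto lines which span a plane where they
  are the only two lines through the image of `p`, then the given lines span a plane where they
  are the only two lines through `p`. -/
@[ext]
structure Hom (G H : OG.{u}) where
  toFun : G.Point → Option H.Point
  map_none : ∀ p q r, {p, q, r} ∈ G.lines → toFun p = none → toFun q = toFun r
  map_some : ∀ p q r p' q' r', {p, q, r} ∈ G.lines →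
    toFun p = some p' → toFun q = some q' → toFun r = some r' → {p', q', r'} ∈ H.lines
  map_plane : ∀ a b c d u v w a' b' c' d', G.IsPlane a b c d u v w →
    toFun a = some a' → toFun b = some b' → toFun c = some c' → toFun d = some d' →
    ∃ u' v' w', toFun u = some u' ∧ toFun v = some v' ∧ toFun w = some w' ∧
      H.IsPlane a' b' c' d' u' v' w'
  reflect_plane : ∀ p q r s t p' q' r' s' t' v' w',
    {q, r, p} ∈ G.lines → {s, t, p} ∈ G.lines → toFun p = some p' →
    toFun q = some q' → toFun r = some r' → toFun s = some s' → toFun t = some t' →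
    H.IsPlane q' r' s' t' p' v' w' → ∃ v w, G.IsPlane q r s t p v w

/-- The identity morphism. -/
def Hom.id (G : OG.{u}) : Hom G G where
  toFun := some
  map_none := by simp
  map_some := by
    rintro p q r p' q' r' h ⟨⟩ ⟨⟩ ⟨⟩
    exact h
  map_plane := by
    rintro a b c d u v w a' b' c' d' h ⟨⟩ ⟨⟩ ⟨⟩ ⟨⟩
    exact ⟨u, v, w, rfl, rfl, rfl, h⟩
  reflect_plane := by
    rintro p q r s t p' q' r' s' t' v' w' _ _ ⟨⟩ ⟨⟩ ⟨⟩ ⟨⟩ ⟨⟩ h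
    exact ⟨v', w', h⟩

/-- Composition of partial functions. -/
def Hom.comp {G H K : OG.{u}} (α : Hom G H) (β : Hom H K) : Hom G K where
  toFun p := (α.toFun p).bind β.toFun
  map_none := by
    intro p q r h hp
    have hqpr : ({q, p, r} : Set G.Point) ∈ G.lines := by rwa [Set.insert_comm]
    have hrpq : ({r, p, q} : Set G.Point) ∈ G.lines := by
      rwa [Set.insert_comm, Set.pair_comm]
    rcases h1 : α.toFun p with _ | x
    · rw [α.map_none p q r h h1]
    rcases h2 : α.toFun q with _ | y
    · rw [← α.map_none q p r hqpr h2, hp]; rfl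
    rcases h3 : α.toFun r with _ | z
    · rw [h1] at hp
      rw [← h2, ← α.map_none r p q hrpq h3, h1, hp]; rfl
    · rw [h1] at hp
      exact β.map_none x y z (α.map_some p q r x y z h h1 h2 h3) hp
  map_some := by
    intro p q r p' q' r' h hp hq hr
    obtain ⟨x, hx, hx'⟩ := Option.bind_eq_some_iff.1 hp
    obtain ⟨y, hy, hy'⟩ := Option.bind_eq_some_iff.1 hq
    obtain ⟨z, hz, hz'⟩ := Option.bind_eq_some_iff.1 hr
    exact β.map_some x y z p' q' r' (α.map_some p q r x y z h hx hy hz) hx' hy' hz'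
  map_plane := by
    intro a b c d u v w a' b' c' d' h ha hb hc hd
    obtain ⟨a₁, ha, ha'⟩ := Option.bind_eq_some_iff.1 ha
    obtain ⟨b₁, hb, hb'⟩ := Option.bind_eq_some_iff.1 hb
    obtain ⟨c₁, hc, hc'⟩ := Option.bind_eq_some_iff.1 hc
    obtain ⟨d₁, hd, hd'⟩ := Option.bind_eq_some_iff.1 hd
    obtain ⟨u₁, v₁, w₁, hu, hv, hw, h₁⟩ := α.map_plane _ _ _ _ _ _ _ _ _ _ _ h ha hb hc hd
    obtain ⟨u', v', w', hu', hv', hw', h'⟩ :=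
      β.map_plane _ _ _ _ _ _ _ _ _ _ _ h₁ ha' hb' hc' hd'
    refine ⟨u', v', w', ?_, ?_, ?_, h'⟩
    · rw [hu]; exact hu'
    · rw [hv]; exact hv'
    · rw [hw]; exact hw'
  reflect_plane := by
    intro p q r s t p' q' r' s' t' v' w' hl hm hp hq hr hs ht h
    obtain ⟨p₁, hp, hp'⟩ := Option.bind_eq_some_iff.1 hp
    obtain ⟨q₁, hq, hq'⟩ := Option.bind_eq_some_iff.1 hq
    obtain ⟨r₁, hr, hr'⟩ := Option.bind_eq_some_iff.1 hr
    obtain ⟨s₁, hs, hs'⟩ := Option.bind_eq_some_iff.1 hs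
    obtain ⟨t₁, ht, ht'⟩ := Option.bind_eq_some_iff.1 ht
    obtain ⟨v₁, w₁, h₁⟩ := β.reflect_plane _ _ _ _ _ _ _ _ _ _ _ _
      (α.map_some _ _ _ _ _ _ hl hq hr hp) (α.map_some _ _ _ _ _ _ hm hs ht hp)
      hp' hq' hr' hs' ht' h
    exact α.reflect_plane _ _ _ _ _ _ _ _ _ _ _ _ hl hm hp hq hr hs ht h₁

/-- The category of orthogeometries. -/
instance : Category OG.{u} where
  Hom := Hom
  id := Hom.id
  comp := Hom.comp
  id_comp _ := rfl
  comp_id α := Hom.ext (funext fun p => Option.bind_fun_some (α.toFun p))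
  assoc α β γ := Hom.ext (funext fun p => Option.bind_assoc (α.toFun p) β.toFun γ.toFun)

/-- A morphism `α : G ⟶ H` of orthogeometries is proper if each small set, that is the empty
set, a set consisting of one point, or a line, is contained in a Boolean set of points whose image
under `α` has more than one point. -/
def IsProper {G H : OG.{u}} (α : G ⟶ H) : Prop :=
  ∀ C : Set G.Point, (C = ∅ ∨ (∃ p, C = {p}) ∨ C ∈ G.lines) →
    ∃ S : Set G.Point, G.IsBooleanSet S ∧ C ⊆ S ∧
      1 < {q : H.Point | ∃ p ∈ S, OG.Hom.toFun α p = some q}.encard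

end OG

/-! Everything is expressed by triads, that is, three pairwise orthogonal elements with join 1; that
this relation is symmetric is the orthomodular law (`IsTriad.rotate`). A point is a complementary
pair {a, a'}, a line is a triad of nonzero elements, and a plane is a splitting of 1 into four
nonzero orthogonal elements (`IsTetrad.isPlane`, `exists_isTetrad_of_isPlane`). A line remembers
which element of each of its pairs belongs to the triad, because a triad of nonzero elements is
determined by two of its points (`IsTriad.eq_of_pt_eq`). Morphisms of orthomodular posets preserve
triads and tetrads; this gives the functor.

Conversely, a morphism of geometries only yields an unoriented map `Φ`: it sends a to a pair {y,
y'}, or to {0, 1} if a is null. Lifting it means choosing y. If a belongs to a triad without null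
members, the image line makes the choice. Condition 3 makes any two such triads through a agree
(`eq_of_same`), and condition 2 makes triads through a and through a' give complementary values
(`eq_compl_of_opposite`). A null a that is orthogonal to a non-null element must go to 0. These
rules are consistent, so `exists_isOrientation` extends them to all of A, arbitrarily where they are
silent.

The resulting map preserves triads without null members. For the others properness is needed: a
Boolean subalgebra that contains the triad and has two nontrivial values forces members of the triad
to have enough non-null pieces to fix the orientation (`exists_split_of_ne`, `exists_split_of_eq`).
The same argument shows that the rules decide at a or at a' for every a, whence uniqueness
(`exists_orientedAt`). The two notions of properness agree because Boolean sets of points correspond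
to Boolean subalgebras. This rests on a criterion: a set containing 0 and closed under complements
is a Boolean subalgebra as soon as any two elements have a common refinement in it
(`isBooleanSubalgebra_of_splitIn`).

An isomorphism of geometries kills no point, so only 0 and 1 are null, and every orientation is an
isomorphism without any properness (`nonempty_iso_of_isUnoriented`). -/

namespace OrthomodularPoset

/-! ### Triads and tetrads in an orthomodular poset. -/

variable {A : Type u} [OrthomodularPoset A] {a b c d p q r s t u v x y z : A}

@[simp] theorem compl_compl' (a : A) : aᶜᶜ = a := oc_invol a

theorem compl_le_compl' (h : a ≤ b) : bᶜ ≤ aᶜ := oc_antitone a b h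

theorem le_compl_comm' (h : a ≤ bᶜ) : b ≤ aᶜ := by
  simpa using compl_le_compl' h

theorem compl_le_comm' (h : aᶜ ≤ b) : bᶜ ≤ a := by
  simpa using compl_le_compl' h

theorem le_of_compl_le (h : aᶜ ≤ bᶜ) : b ≤ a := by
  simpa using compl_le_compl' h

theorem eq_bot_of_le_compl (h : a ≤ aᶜ) : a = ⊥ := oc_disjoint a a le_rfl h

theorem eq_bot_of_le_of_le_compl (h : a ≤ b) (h' : a ≤ bᶜ) : a = ⊥ := oc_disjoint b a h h'

@[simp] theorem compl_top' : (⊤ : A)ᶜ = ⊥ := eq_bot_of_le_of_le_compl le_top le_rfl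

@[simp] theorem compl_bot' : (⊥ : A)ᶜ = ⊤ := by rw [← compl_top', compl_compl']

theorem compl_injective' : Function.Injective (compl : A → A) := fun a b h => by
  rw [← compl_compl' a, h, compl_compl']

@[simp] theorem compl_eq_bot' : aᶜ = ⊥ ↔ a = ⊤ := by
  rw [← compl_top', compl_injective'.eq_iff]

@[simp] theorem compl_eq_top' : aᶜ = ⊤ ↔ a = ⊥ := by
  rw [← compl_bot', compl_injective'.eq_iff]

theorem eq_top_of_le_of_compl_le (h : a ≤ b) (h' : aᶜ ≤ b) : b = ⊤ := by
  rw [← compl_eq_bot']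
  exact eq_bot_of_le_of_le_compl (compl_le_comm' h') (compl_le_compl' h)

/-- Three pairwise orthogonal elements whose join is `⊤`. -/
def IsTriad (a b c : A) : Prop := IsOrthosum a b cᶜ

theorem isOrthosum_iff :
    IsOrthosum a b c ↔ a ≤ bᶜ ∧ a ≤ c ∧ b ≤ c ∧ ∀ x, a ≤ x → b ≤ x → c ≤ x := by
  simp only [IsOrthosum, IsLUB, IsLeast, upperBounds, lowerBounds, Set.mem_insert_iff,
    Set.mem_singleton_iff, forall_eq_or_imp, forall_eq, Set.mem_ofPred_eq, and_imp, and_assoc]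

theorem isTriad_iff :
    IsTriad a b c ↔ a ≤ bᶜ ∧ a ≤ cᶜ ∧ b ≤ cᶜ ∧ ∀ x, a ≤ x → b ≤ x → cᶜ ≤ x :=
  isOrthosum_iff

theorem isOrthosum_iff_isTriad : IsOrthosum a b c ↔ IsTriad a b cᶜ := by simp [IsTriad]

namespace IsTriad

theorem swap (h : IsTriad a b c) : IsTriad b a c :=
  ⟨le_compl_comm' h.1, by rw [Set.pair_comm]; exact h.2⟩

theorem rotate (h : IsTriad a b c) : IsTriad b c a := by
  obtain ⟨h1, -, h3, -⟩ := isTriad_iff.1 h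
  refine ⟨h3, ?_⟩
  have := orthomodular_law b aᶜ (le_compl_comm' h1) cᶜ (by simpa using h.swap.2)
  simpa using this

theorem rotate' (h : IsTriad a b c) : IsTriad c a b := h.rotate.rotate

theorem le₁₃ (h : IsTriad a b c) : a ≤ cᶜ := h.rotate'.swap.1

theorem le₂₃ (h : IsTriad a b c) : b ≤ cᶜ := h.rotate.1

theorem compl_le (h : IsTriad a b c) (ha : a ≤ x) (hb : b ≤ x) : cᶜ ≤ x :=
  (isTriad_iff.1 h).2.2.2 x ha hb

theorem unique (h : IsTriad a b c) (h' : IsTriad a b d) : c = d :=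
  compl_injective' (h.2.unique h'.2)

end IsTriad

theorem isTriad_bot (a : A) : IsTriad a aᶜ ⊥ := by
  rw [isTriad_iff]
  simp only [compl_compl', compl_bot', le_refl, le_top, true_and, top_le_iff]
  exact fun x => eq_top_of_le_of_compl_le

theorem isTriad_bot_iff : IsTriad a b ⊥ ↔ b = aᶜ :=
  ⟨fun h => h.rotate'.swap.unique (isTriad_bot a).rotate'.swap, fun h => h ▸ isTriad_bot a⟩

theorem isTriad_bot_iff' : IsTriad ⊥ a b ↔ b = aᶜ :=
  ⟨fun h => isTriad_bot_iff.1 h.rotate, fun h => (isTriad_bot_iff.2 h).rotate'⟩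

theorem isTriad_bot_iff'' : IsTriad a ⊥ b ↔ b = aᶜ :=
  ⟨fun h => isTriad_bot_iff'.1 h.swap, fun h => (isTriad_bot_iff'.2 h).swap⟩

theorem exists_isTriad (h : a ≤ bᶜ) : ∃ c, IsTriad a b c := by
  obtain ⟨c, hc⟩ := exists_orthogonal_join a b h
  exact ⟨cᶜ, h, by simpa using hc⟩

theorem IsTriad.ne_top (h : IsTriad a b c) (hb : b ≠ ⊥) : a ≠ ⊤ := by
  rintro rfl
  exact hb (by simpa using h.swap.1)

theorem IsTriad.eq_bot_of_eq_top (h : IsTriad a b c) (ha : a = ⊤) : b = ⊥ ∧ c = ⊥ := by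
  subst ha
  exact ⟨by simpa using h.swap.1, by simpa using h.rotate'.1⟩

/-- Four pairwise orthogonal elements `a b c d` with join `⊤`, together with the complements
`u`, `v`, `w` of `a ⊕ b`, `a ⊕ c`, `a ⊕ d`. -/
structure IsTetrad (a b c d u v w : A) : Prop where
  ab : IsTriad a b u
  cd : IsTriad c d uᶜ
  ac : IsTriad a c v
  bd : IsTriad b d vᶜ
  ad : IsTriad a d w
  bc : IsTriad b c wᶜ

/-- Both a and c are orthogonal to b and d, so a ⊕ c and b ⊕ d are orthogonal. An upper bound of
both lies above u and uᶜ, hence is 1, so the two sums are complementary. -/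
theorem IsTriad.exists_middle (h : IsTriad a b u) (h' : IsTriad c d uᶜ) :
    ∃ v, IsTriad a c v ∧ IsTriad b d vᶜ := by
  have hau := h.le₁₃
  have hbu := h.le₂₃
  have hcu : c ≤ u := by simpa using h'.le₁₃
  have hdu : d ≤ u := by simpa using h'.le₂₃
  obtain ⟨v, hv⟩ := exists_isTriad (hau.trans (compl_le_compl' hcu))
  obtain ⟨t, ht⟩ := exists_isTriad (hbu.trans (compl_le_compl' hdu))
  have hvt : vᶜ ≤ tᶜᶜ := by
    rw [compl_compl']
    refine hv.compl_le (le_compl_comm' (ht.compl_le ?_ ?_))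
      (le_compl_comm' (ht.compl_le ?_ ?_)) |>.trans (by simp)
    · exact h.swap.1
    · exact le_compl_comm' (hau.trans (compl_le_compl' hdu))
    · exact hbu.trans (compl_le_compl' hcu)
    · exact h'.swap.1
  obtain ⟨r, hr⟩ := exists_isTriad hvt
  have hr0 : r = ⊥ := by
    rw [← compl_eq_top']
    have hvr := hr.le₁₃
    have htr := hr.le₂₃
    exact eq_top_of_le_of_compl_le
      (h'.compl_le (hv.swap.le₁₃.trans hvr) (ht.swap.le₁₃.trans htr) |>.trans' (by simp))
      (h.compl_le (hv.le₁₃.trans hvr) (ht.le₁₃.trans htr))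
  subst hr0
  have : t = vᶜ := by simpa using congrArg compl (isTriad_bot_iff.1 hr)
  exact ⟨v, hv, this ▸ ht⟩

theorem IsTriad.exists_isTetrad (h : IsTriad a b u) (h' : IsTriad c d uᶜ) :
    ∃ v w, IsTetrad a b c d u v w := by
  obtain ⟨v, h1, h2⟩ := h.exists_middle h'
  obtain ⟨w, h3, h4⟩ := h.exists_middle h'.swap
  exact ⟨v, w, h, h', h1, h2, h3, h4⟩

/-! ### Subalgebras generated by an element or a triad. -/

/-- The subalgebra generated by one element. -/
def pt (a : A) : Set A := {⊥, ⊤, a, aᶜ}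

/-- The subalgebra generated by a triad. -/
def tri (a b c : A) : Set A := {⊥, ⊤, a, aᶜ, b, bᶜ, c, cᶜ}

@[simp] theorem self_mem_pt : a ∈ pt a := by simp [pt]

@[simp] theorem pt_compl : pt aᶜ = pt a := by
  simp only [pt, compl_compl', Set.pair_comm]

@[simp] theorem pt_top : pt (⊤ : A) = pt ⊥ := by rw [← compl_bot', pt_compl]

theorem mem_pt_bot : a ∈ pt (⊥ : A) ↔ a = ⊥ ∨ a = ⊤ := by
  simp only [pt, Set.mem_insert_iff, Set.mem_singleton_iff, compl_bot']
  tauto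

theorem pt_eq_iff : pt a = pt b ↔ a = b ∨ a = bᶜ := by
  refine ⟨fun h => ?_, ?_⟩
  · have h1 : a ∈ pt b := h ▸ self_mem_pt
    rcases h1 with rfl | rfl | rfl | rfl
    · rcases mem_pt_bot.1 (h ▸ self_mem_pt : b ∈ pt (⊥ : A)) with rfl | rfl <;> simp
    · rw [pt_top] at h
      rcases mem_pt_bot.1 (h ▸ self_mem_pt : b ∈ pt (⊥ : A)) with rfl | rfl <;> simp
    · exact Or.inl rfl
    · exact Or.inr rfl
  · rintro (rfl | rfl) <;> simp

theorem pt_eq_bot_iff : pt a = pt ⊥ ↔ a = ⊥ ∨ a = ⊤ := by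
  rw [pt_eq_iff, compl_bot']

theorem ne_bot_of_pt (h : pt a ≠ pt ⊥) : a ≠ ⊥ := by
  rintro rfl; exact h rfl

theorem ne_compl_self (h : (⊥ : A) ≠ ⊤) : a ≠ aᶜ := by
  intro h'
  have h0 := eq_bot_of_le_compl h'.le
  rw [h0] at h'
  exact h (by simpa using h')

/-- A triad of nonzero elements is determined by two of the points that it spans. -/
theorem IsTriad.eq_of_pt_eq (h : IsTriad a b c) (h' : IsTriad x y z) (ha : a ≠ ⊥) (hb : b ≠ ⊥)
    (hc : c ≠ ⊥) (hx : pt a = pt x) (hy : pt b = pt y) : a = x ∧ b = y ∧ c = z := by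
  -- Complementing just one of the two elements puts a nonzero element below some element and its
  -- complement. Complementing both forces `y = xᶜ`, so the third member of the triad vanishes.
  rcases pt_eq_iff.1 hx with rfl | rfl <;> rcases pt_eq_iff.1 hy with rfl | rfl
  · exact ⟨rfl, rfl, h.unique h'⟩
  · refine absurd (eq_bot_of_le_of_le_compl (b := y) ?_ ?_) ha
    · simpa using h.1
    · exact h'.1
  · refine absurd (eq_bot_of_le_of_le_compl (b := x) ?_ ?_) hb
    · simpa using h.swap.1
    · exact h'.swap.1
  · refine absurd ?_ hc
    have h1 : xᶜ = y := le_antisymm (by simpa using h.1) (le_compl_comm' h'.1)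
    subst h1
    exact ((isTriad_bot xᶜ).unique h).symm

theorem IsTriad.pt_ne (h : IsTriad a b c) (ha : a ≠ ⊥) (hc : c ≠ ⊥) : pt a ≠ pt b := by
  intro h'
  rcases pt_eq_iff.1 h' with rfl | rfl
  · exact ha (eq_bot_of_le_compl h.1)
  · have := (isTriad_bot b).swap
    exact hc (h.unique this)

theorem pt_encard (h : pt a ≠ pt ⊥) : (pt a).encard = 4 := by
  have h1 : a ≠ ⊥ := fun h' => h (h' ▸ rfl)
  have h2 : a ≠ ⊤ := fun h' => h (by rw [h', pt_top])
  have h3 : (⊥ : A) ≠ ⊤ := fun h' => h1 (by rw [← le_bot_iff, h']; exact le_top)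
  have h4 := ne_compl_self (a := a) h3
  have h5 : aᶜ ≠ ⊥ := by simpa using h2
  have h6 : aᶜ ≠ ⊤ := by simpa using h1
  rw [pt, Set.encard_insert_of_notMem, Set.encard_insert_of_notMem, Set.encard_pair h4]
  · rfl
  · simp [h2.symm, h6.symm]
  · simp [h1.symm, h3, h5.symm]

theorem pt_encard_le : (pt a).encard ≤ 4 := by
  unfold pt
  refine (Set.encard_insert_le _ _).trans ?_
  refine (add_le_add_left (Set.encard_insert_le _ _) _).trans ?_
  refine (add_le_add_left (add_le_add_left (Set.encard_insert_le _ _) _) _).trans ?_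
  rw [Set.encard_singleton]; rfl

end OrthomodularPoset

/-! ### Boolean subalgebras: the refinement criterion, charts, and those with at most eight
elements. -/

namespace OrthomodularPoset

variable {A : Type u} [OrthomodularPoset A] {a b c d p q r s t u v x y z w : A} {B : Set A}

/-- The elements `p` and `q` have a common refinement `x, y, z, w` in `B`, where `p = x ⊕ z` and
`q = y ⊕ z`. -/
def SplitIn (B : Set A) (p q : A) : Prop :=
  ∃ x ∈ B, ∃ y ∈ B, ∃ z ∈ B, ∃ w ∈ B,
    IsTriad x z pᶜ ∧ IsTriad y w p ∧ IsTriad y z qᶜ ∧ IsTriad x w q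

namespace SplitIn

theorem symm (h : SplitIn B p q) : SplitIn B q p := by
  obtain ⟨x, hx, y, hy, z, hz, w, hw, h1, h2, h3, h4⟩ := h
  exact ⟨y, hy, x, hx, z, hz, w, hw, h3, h4, h1, h2⟩

theorem compl_left (h : SplitIn B p q) : SplitIn B pᶜ q := by
  obtain ⟨x, hx, y, hy, z, hz, w, hw, h1, h2, h3, h4⟩ := h
  exact ⟨w, hw, z, hz, y, hy, x, hx, by simpa using h2.swap, h1.swap, h3.swap, h4.swap⟩

theorem compl_left_iff : SplitIn B pᶜ q ↔ SplitIn B p q :=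
  ⟨fun h => by simpa using h.compl_left, compl_left⟩

theorem compl_right_iff : SplitIn B p qᶜ ↔ SplitIn B p q :=
  ⟨fun h => (compl_left_iff.1 h.symm).symm, fun h => (compl_left_iff.2 h.symm).symm⟩

theorem of_isTriad (h : IsTriad p q r) (h0 : ⊥ ∈ B) (hp : p ∈ B) (hq : q ∈ B) (hr : r ∈ B) :
    SplitIn B p q :=
  ⟨p, hp, q, hq, ⊥, h0, r, hr, isTriad_bot_iff''.2 rfl, h.rotate, isTriad_bot_iff''.2 rfl,
    h.swap.rotate⟩

theorem refl (h0 : ⊥ ∈ B) (hc : ∀ a ∈ B, aᶜ ∈ B) (hp : p ∈ B) : SplitIn B p p := by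
  have := of_isTriad (isTriad_bot p) h0 hp (hc _ hp) h0
  exact compl_right_iff.1 this

theorem of_pt_eq (h : SplitIn B p q) (hp : pt p = pt a) (hq : pt q = pt b) : SplitIn B a b := by
  rcases pt_eq_iff.1 hp with rfl | rfl <;> rcases pt_eq_iff.1 hq with rfl | rfl <;>
    simpa only [compl_left_iff, compl_right_iff] using h

theorem of_isTetrad (h : IsTetrad x z y w u v r) (hx : x ∈ B) (hy : y ∈ B) (hz : z ∈ B)
    (hw : w ∈ B) : SplitIn B u r :=
  compl_left_iff.1 ⟨x, hx, y, hy, z, hz, w, hw, by simpa using h.ab, h.cd, h.bc.swap, h.ad⟩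

end SplitIn

/-- The complement of z is x ⊕ pᶜ, and t is orthogonal to both summands, to x because x is
orthogonal to q. So the common part z is the meet of p and q in all of A. -/
theorem le_of_split (h1 : IsTriad x z pᶜ) (h4 : IsTriad x w q)
    (hp : t ≤ p) (hq : t ≤ q) : t ≤ z := by
  have h := h1.swap.rotate.compl_le (x := tᶜ) (le_compl_comm' (hq.trans ?_))
    (compl_le_compl' hp)
  · exact le_of_compl_le h
  · exact h4.rotate'.1

/-- Common parts are meets, and complementation turns them into joins. The decisive point is that
elements with meet 0 are orthogonal, since a refinement without common part exhibits orthogonality;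
this yields distributivity. -/
theorem isBooleanSubalgebra_of_splitIn (h0 : ⊥ ∈ B) (hc : ∀ a ∈ B, aᶜ ∈ B)
    (h : ∀ p ∈ B, ∀ q ∈ B, SplitIn B p q) : IsBooleanSubalgebra B := by
  have hinf : ∀ p q : B, ∃ z : B, z ≤ p ∧ z ≤ q ∧ (∀ t : B, t ≤ p → t ≤ q → t ≤ z) ∧
      (z.1 = ⊥ → p.1 ≤ q.1ᶜ) := by
    rintro ⟨p, hp⟩ ⟨q, hq⟩
    obtain ⟨x, hx, y, hy, z, hz, w, hw, h1, h2, h3, h4⟩ := h p hp q hq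
    refine ⟨⟨z, hz⟩, ?_, ?_, ?_, ?_⟩
    · simpa using h1.le₂₃
    · simpa using h3.le₂₃
    · rintro ⟨t, ht⟩ htp htq
      exact le_of_split h1 h4 htp htq
    · rintro rfl
      have e1 := isTriad_bot_iff''.1 h1
      change p ≤ qᶜ
      rw [compl_injective' e1]
      exact h4.le₁₃
  choose inf hl hr hg hd using hinf
  let co : B → B := fun a => ⟨a.1ᶜ, hc _ a.2⟩
  have hco : ∀ a, co (co a) = a := fun a => Subtype.ext (compl_compl' _)
  have hcole : ∀ {a b}, a ≤ co b → b ≤ co a := fun {a b} h => le_compl_comm' h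
  have hcole' : ∀ {a b}, co a ≤ b → co b ≤ a := fun {a b} h => compl_le_comm' h
  let bo : B := ⟨⊥, h0⟩
  have hbo : ∀ a, bo ≤ a := fun a => bot_le (a := a.1)
  have hdis : ∀ {a b}, inf a b ≤ bo → a ≤ co b := fun {a b} h =>
    hd a b (le_bot_iff.1 h)
  have hdis' : ∀ {t a}, t ≤ a → t ≤ co a → t ≤ bo := fun {t a} h1 h2 =>
    (eq_bot_of_le_of_le_compl h1 h2).le
  let L : Lattice B :=
    { (inferInstance : PartialOrder B) with
      inf := inf
      sup := fun a b => co (inf (co a) (co b))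
      inf_le_left := hl
      inf_le_right := hr
      le_inf := fun a b c h1 h2 => hg _ _ _ h1 h2
      le_sup_left := fun a b => hcole (hl _ _)
      le_sup_right := fun a b => hcole (hr _ _)
      sup_le := fun a b c h1 h2 => hcole' (hg _ _ _ (compl_le_compl' h1) (compl_le_compl' h2)) }
  have hdist : ∀ a b c : B, a ⊓ (b ⊔ c) ≤ a ⊓ b ⊔ a ⊓ c := by
    intro a b c
    rw [← hco (a ⊓ b ⊔ a ⊓ c)]
    -- It suffices that m = a ∧ (b ∨ c) ∧ y' is 0. Its meets with b and with c lie below both y and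
    -- y', so m is orthogonal to b and to c, hence to b ∨ c, above which it cannot be nonzero while
    -- lying below b ∨ c.
    apply hdis
    set y := a ⊓ b ⊔ a ⊓ c
    have hx : ∀ e : B, a ⊓ e ≤ y → inf (a ⊓ (b ⊔ c)) (co y) ≤ co e := fun e he =>
      hdis (hdis' (a := y) ((hg _ _ _ ((hl _ _).trans ((hl _ _).trans (hl _ _))) (hr _ _)).trans he)
        ((hl _ _).trans (hr _ _)))
    refine hdis' (a := b ⊔ c) ((hl _ _).trans (hr _ _)) ?_
    refine (hg (co b) (co c) _ (hx b le_sup_left) (hx c le_sup_right)).trans ?_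
    rw [← hco (inf (co b) (co c))]
    exact le_rfl
  let D : DistribLattice B := DistribLattice.ofInfSupLe hdist
  have ht : ⊤ ∈ B := by simpa using hc _ h0
  let X : BooleanAlgebra B :=
    { D with
      compl := co
      top := ⟨⊤, ht⟩
      bot := bo
      le_top := fun a => le_top (a := a.1)
      bot_le := hbo
      inf_compl_le_bot := fun a => hdis' (hl _ _) (hr _ _)
      top_le_sup_compl := fun a => by
        have : inf (co a) (co (co a)) ≤ bo := hdis' (hl _ _) (hr _ _)
        exact (compl_bot' (A := A)).ge.trans (compl_le_compl' this) }
  refine ⟨h0, ht, hc, ?_, B, X, ⟨OrderIso.refl _⟩⟩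
  intro p hp q hq c hpq
  obtain ⟨x, hx, y, hy, z, hz, w, hw, h1, h2, h3, h4⟩ := h p hp q hq
  have hz0 : z = ⊥ := by
    refine eq_bot_of_le_of_le_compl (b := q) (by simpa using h3.le₂₃) (le_trans ?_ hpq.1)
    simpa using h1.le₂₃
  subst hz0
  have hyq : q = y := compl_injective' (isTriad_bot_iff''.1 h3)
  subst hyq
  rw [isOrthosum_iff_isTriad] at hpq
  have := hpq.unique h2.rotate'
  have := hc _ hw
  rwa [← ‹cᶜ = w›, compl_compl'] at this

theorem IsTriad.isBooleanSubalgebra_tri (h : IsTriad a b c) : IsBooleanSubalgebra (tri a b c) := by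
  have h0 : ⊥ ∈ tri a b c := by simp [tri]
  have ha : a ∈ tri a b c := by simp [tri]
  have hb : b ∈ tri a b c := by simp [tri]
  have hc : c ∈ tri a b c := by simp [tri]
  have hcl : ∀ x ∈ tri a b c, xᶜ ∈ tri a b c := by
    intro x hx
    simp only [tri, Set.mem_insert_iff, Set.mem_singleton_iff] at hx ⊢
    rcases hx with rfl | rfl | rfl | rfl | rfl | rfl | rfl | rfl <;> simp
  refine isBooleanSubalgebra_of_splitIn h0 hcl fun p hp q hq => ?_
  have key : ∀ p ∈ ({⊥, a, b, c} : Set A), ∀ q ∈ ({⊥, a, b, c} : Set A),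
      SplitIn (tri a b c) p q := by
    have hbot : ∀ x ∈ tri a b c, SplitIn (tri a b c) ⊥ x := fun x hx =>
      .of_isTriad (isTriad_bot_iff'.2 rfl) h0 h0 hx (hcl x hx)
    have hab : SplitIn (tri a b c) a b := .of_isTriad h h0 ha hb hc
    have hbc : SplitIn (tri a b c) b c := .of_isTriad h.rotate h0 hb hc ha
    have hca : SplitIn (tri a b c) c a := .of_isTriad h.rotate' h0 hc ha hb
    rintro p (rfl | rfl | rfl | rfl) q (rfl | rfl | rfl | rfl)
    exacts [hbot _ h0, hbot _ ha, hbot _ hb, hbot _ hc,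
      (hbot _ ha).symm, .refl h0 hcl ha, hab, hca.symm,
      (hbot _ hb).symm, hab.symm, .refl h0 hcl hb, hbc,
      (hbot _ hc).symm, hca, hbc.symm, .refl h0 hcl hc]
  have flip : ∀ p ∈ tri a b c, ∃ p' ∈ ({⊥, a, b, c} : Set A), p = p' ∨ p = p'ᶜ := by
    intro p hp
    simp only [tri, Set.mem_insert_iff, Set.mem_singleton_iff] at hp
    simp only [Set.mem_insert_iff, Set.mem_singleton_iff, exists_eq_or_imp, exists_eq_left,
      compl_bot']
    tauto
  obtain ⟨p', hp', hpp⟩ := flip p hp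
  obtain ⟨q', hq', hqq⟩ := flip q hq
  exact (key p' hp' q' hq').of_pt_eq (pt_eq_iff.2 hpp).symm (pt_eq_iff.2 hqq).symm

theorem tri_bot : tri a aᶜ ⊥ = pt a := by
  ext x
  simp only [tri, pt, Set.mem_insert_iff, Set.mem_singleton_iff, compl_compl', compl_bot']
  tauto

theorem isBooleanSubalgebra_pt (a : A) : IsBooleanSubalgebra (pt a) :=
  tri_bot (a := a) ▸ (isTriad_bot a).isBooleanSubalgebra_tri

theorem _root_.IsBooleanSubalgebra.pt_subset (h : IsBooleanSubalgebra B) (ha : a ∈ B) :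
    pt a ⊆ B := by
  rintro x (rfl | rfl | rfl | rfl)
  exacts [h.bot_mem, h.top_mem, ha, h.compl_mem _ ha]

theorem tri_eq_union : tri a b c = pt a ∪ pt b ∪ pt c := by
  ext x
  simp only [tri, pt, Set.mem_insert_iff, Set.mem_singleton_iff, Set.mem_union]
  tauto

theorem _root_.IsBooleanSubalgebra.tri_subset (h : IsBooleanSubalgebra B) (ha : a ∈ B)
    (hb : b ∈ B) (hc : c ∈ B) : tri a b c ⊆ B := by
  rw [tri_eq_union]
  exact Set.union_subset (Set.union_subset (h.pt_subset ha) (h.pt_subset hb)) (h.pt_subset hc)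

/-- A map from a Boolean algebra that turns complements into orthocomplements and disjoint
suprema into orthogonal sums. -/
structure IsBooleanChart {X : Type u} [BooleanAlgebra X] (i : X → A) : Prop where
  map_compl : ∀ x, i xᶜ = (i x)ᶜ
  isOrthosum : ∀ x y, Disjoint x y → IsOrthosum (i x) (i y) (i (x ⊔ y))

/-- Complements agree because the orthocomplement lies in B, is a lattice complement there, and
complements in a Boolean algebra are unique. Disjoint suprema agree because the orthogonal sum
formed in A lies in B. -/
theorem _root_.IsBooleanSubalgebra.exists_chart (h : IsBooleanSubalgebra B) :
    ∃ (X : Type u) (_ : BooleanAlgebra X) (i : X → A), IsBooleanChart i ∧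
      Function.Injective i ∧ Set.range i = B ∧ i ⊥ = ⊥ := by
  obtain ⟨X, _, ⟨e⟩⟩ := h.boolean
  have hle : ∀ x y, (e x).1 ≤ (e y).1 ↔ x ≤ y := fun x y => e.le_iff_le
  have hsurj : ∀ a ∈ B, ∃ x, (e x).1 = a := fun a ha => ⟨e.symm ⟨a, ha⟩, by simp⟩
  have hbot : (e ⊥).1 = ⊥ := by
    obtain ⟨x, hx⟩ := hsurj _ h.bot_mem
    rw [← le_bot_iff, ← hx, hle]
    exact bot_le
  have htop : (e ⊤).1 = ⊤ := by
    obtain ⟨x, hx⟩ := hsurj _ h.top_mem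
    rw [← top_le_iff, ← hx, hle]
    exact le_top
  have hcompl : ∀ x, (e xᶜ).1 = (e x).1ᶜ := by
    intro x
    obtain ⟨y, hy⟩ := hsurj _ (h.compl_mem _ (e x).2)
    rw [← hy]
    congr 2
    refine (IsCompl.of_eq ?_ ?_).compl_eq
    · rw [← le_bot_iff, ← hle, hbot]
      refine (eq_bot_of_le_of_le_compl (b := (e x).1) ((hle _ _).2 inf_le_left) ?_).le
      rw [← hy]
      exact (hle _ _).2 inf_le_right
    · rw [← top_le_iff, ← hle, htop]
      refine (eq_top_of_le_of_compl_le (a := (e x).1) ((hle _ _).2 le_sup_left) ?_).ge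
      rw [← hy]
      exact (hle _ _).2 le_sup_right
  refine ⟨X, _, fun x => (e x).1, ⟨hcompl, fun x y hxy => ?_⟩,
    Subtype.val_injective.comp e.injective, ?_, hbot⟩
  · have horth : (e x).1 ≤ (e y).1ᶜ := by
      rw [← hcompl, hle]
      exact hxy.le_compl_right
    obtain ⟨c, hc⟩ := exists_orthogonal_join _ _ horth
    obtain ⟨z, rfl⟩ := hsurj c (h.orthosum_mem _ (e x).2 _ (e y).2 c ⟨horth, hc⟩)
    obtain ⟨-, h1, h2, h3⟩ := isOrthosum_iff.1 ⟨horth, hc⟩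
    have : z = x ⊔ y := by
      apply le_antisymm
      · rw [← hle]
        exact h3 _ ((hle _ _).2 le_sup_left) ((hle _ _).2 le_sup_right)
      · exact sup_le ((hle _ _).1 h1) ((hle _ _).1 h2)
    exact ⟨horth, this ▸ hc⟩
  · ext a
    constructor
    · rintro ⟨x, rfl⟩
      exact (e x).2
    · exact hsurj a

theorem IsBooleanChart.isTriad {X : Type u} [BooleanAlgebra X] {i : X → A} (h : IsBooleanChart i)
    {x y z : X} (hxy : Disjoint x y) (hz : z = (x ⊔ y)ᶜ) : IsTriad (i x) (i y) (i z) := by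
  subst hz
  rw [IsTriad, ← h.map_compl, _root_.compl_compl]
  exact h.isOrthosum x y hxy

theorem tri_encard (h : IsTriad a b c) (ha : a ≠ ⊥) (hb : b ≠ ⊥) (hc : c ≠ ⊥) :
    (tri a b c).encard = 8 := by
  have h1 := h.pt_ne ha hc
  have h2 := h.rotate.pt_ne hb ha
  have h3 := h.swap.rotate.pt_ne ha hb
  have e1 : a ≠ b := fun e => h1 (e ▸ rfl)
  have e2 : a ≠ bᶜ := fun e => h1 (e ▸ pt_compl)
  have e3 : b ≠ c := fun e => h2 (e ▸ rfl)
  have e4 : b ≠ cᶜ := fun e => h2 (e ▸ pt_compl)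
  have e5 : a ≠ c := fun e => h3 (e ▸ rfl)
  have e6 : a ≠ cᶜ := fun e => h3 (e ▸ pt_compl)
  have f1 : a ≠ ⊤ := h.ne_top hb
  have f2 : b ≠ ⊤ := h.rotate.ne_top hc
  have f3 : c ≠ ⊤ := h.rotate'.ne_top ha
  have ht : (⊥ : A) ≠ ⊤ := fun e => ha (by rw [← le_bot_iff, e]; exact le_top)
  have c1 := ne_compl_self (a := a) ht
  have c2 := ne_compl_self (a := b) ht
  have c3 := ne_compl_self (a := c) ht
  have e2' : aᶜ ≠ b := fun e => e2 (by rw [← e, compl_compl'])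
  have e4' : bᶜ ≠ c := fun e => e4 (by rw [← e, compl_compl'])
  have e6' : aᶜ ≠ c := fun e => e6 (by rw [← e, compl_compl'])
  have k : ∀ x : A, x ≠ ⊥ → ⊤ ≠ xᶜ := fun x hx e => hx (compl_eq_top'.1 e.symm)
  have k' : ∀ x : A, x ≠ ⊤ → ⊥ ≠ xᶜ := fun x hx e => hx (compl_eq_bot'.1 e.symm)
  rw [tri, Set.encard_insert_of_notMem, Set.encard_insert_of_notMem, Set.encard_insert_of_notMem,
    Set.encard_insert_of_notMem, Set.encard_insert_of_notMem, Set.encard_insert_of_notMem,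
    Set.encard_pair c3]
  · rfl
  all_goals simp only [Set.mem_insert_iff, Set.mem_singleton_iff, not_or, compl_injective'.eq_iff]
  exacts [⟨e4', e3⟩, ⟨c2, e3, e4⟩, ⟨e2', e1, e6', e5⟩, ⟨c1, e1, e2, e5, e6⟩,
    ⟨f1.symm, k _ ha, f2.symm, k _ hb, f3.symm, k _ hc⟩,
    ⟨ht, ha.symm, k' _ f1, hb.symm, k' _ f2, hc.symm, k' _ f3⟩]

/-- Different subfamilies have different suprema: a member outside a subfamily is nonzero and
disjoint from its supremum. -/
theorem _root_.two_pow_le_encard_of_pairwise_disjoint {X : Type*} [DistribLattice X] [OrderBot X]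
    {n : ℕ} {f : Fin n → X} (hf : Pairwise (Function.onFun Disjoint f)) (h0 : ∀ i, f i ≠ ⊥) :
    (2 ^ n : ℕ) ≤ (Set.univ : Set X).encard := by
  have hsub : ∀ S T : Finset (Fin n), S.sup f = T.sup f → S ⊆ T := by
    intro S T h i hi
    by_contra hiT
    have h1 : f i ≤ T.sup f := h ▸ Finset.le_sup hi
    have h2 : Disjoint (f i) (T.sup f) := Finset.disjoint_sup_right.2 fun j hj =>
      hf (by rintro rfl; exact hiT hj)
    exact h0 i (h2.eq_bot_of_le h1)
  have hinj : Function.Injective fun S : Finset (Fin n) => S.sup f := fun S T h =>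
    (hsub S T h).antisymm (hsub T S h.symm)
  have := hinj.encard_image Set.univ
  calc ((2 ^ n : ℕ) : ℕ∞) = (Set.univ : Set (Finset (Fin n))).encard := by
        simp [Set.encard_univ]
    _ ≤ _ := this ▸ Set.encard_le_encard (Set.subset_univ _)

theorem _root_.IsBooleanSubalgebra.exists_triad (h : IsBooleanSubalgebra B)
    (hB : B.encard ≤ 8) : ∃ a b c : A, IsTriad a b c ∧ B = tri a b c := by
  by_cases h2 : ∃ a, B = pt a
  · obtain ⟨a, rfl⟩ := h2
    exact ⟨a, aᶜ, ⊥, isTriad_bot a, tri_bot.symm⟩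
  push Not at h2
  obtain ⟨X, _, i, hi, hinj, hr, hbot⟩ := h.exists_chart
  have hcard : (Set.univ : Set X).encard ≤ 8 := by
    rw [← hinj.encard_image, Set.image_univ, hr]
    exact hB
  have hmem : ∀ x, i x ∈ B := fun x => hr ▸ Set.mem_range_self x
  have hex : ∀ a ∈ B, ∃ x : X, i x ∉ pt a := by
    intro a ha
    by_contra! hcon
    refine h2 a (Set.Subset.antisymm ?_ (h.pt_subset ha))
    rw [← hr]
    rintro _ ⟨x, rfl⟩
    exact hcon x
  obtain ⟨a, ha⟩ := hex ⊥ h.bot_mem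
  obtain ⟨b, hb⟩ := hex (i a) (hmem a)
  have hne : ∀ {x : X}, i x ≠ ⊥ → x ≠ ⊥ := by rintro _ h rfl; exact h hbot
  have key : ∃ x y : X, Disjoint x y ∧ x ≠ ⊥ ∧ y ≠ ⊥ ∧ x ⊔ y ≠ ⊤ := by
    have ha1 : a ≠ ⊥ := by rintro rfl; exact ha (by simp [hbot])
    have ha2 : a ≠ ⊤ := by
      rintro rfl; exact ha (by rw [← compl_bot, hi.map_compl, hbot]; simp [mem_pt_bot])
    have hb1 : b ≠ ⊥ := by rintro rfl; exact hb (by simp [pt, hbot])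
    have hb2 : b ≠ ⊤ := by
      rintro rfl; exact hb (by rw [← compl_bot, hi.map_compl, hbot]; simp [pt])
    have hab1 : a ≠ b := by rintro rfl; exact hb self_mem_pt
    have hab2 : a ≠ bᶜ := by
      rintro rfl; rw [hi.map_compl, pt_compl] at hb; exact hb self_mem_pt
    have hsup : ∀ x y : X, x ⊔ y = ⊤ → Disjoint x y → x = yᶜ := fun x y h1 h2 =>
      (IsCompl.of_eq h2.eq_bot h1).symm.compl_eq.symm
    -- If disjoint nonzero elements were always complementary, the four cells cut out by a and b
    -- would all be nonzero, giving 16 elements.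
    by_contra! hcon
    have : ∀ x y : X, x ≠ ⊥ → y ≠ ⊥ → x ≠ yᶜ → ¬ Disjoint x y := fun x y hx hy hxy hd =>
      hxy (hsup x y (hcon x y hd hx hy) hd)
    have hac : aᶜ ≠ ⊥ := by simpa using ha2
    have hbc : bᶜ ≠ ⊥ := by simpa using hb2
    have n1 : a ⊓ b ≠ ⊥ := fun e => this a b ha1 hb1 hab2 (disjoint_iff.2 e)
    have n2 : a ⊓ bᶜ ≠ ⊥ := fun e => this a bᶜ ha1 hbc (by simpa using hab1) (disjoint_iff.2 e)
    have n3 : aᶜ ⊓ b ≠ ⊥ := fun e => this aᶜ b hac hb1 (by simpa using hab1) (disjoint_iff.2 e)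
    have n4 : aᶜ ⊓ bᶜ ≠ ⊥ := fun e =>
      this aᶜ bᶜ hac hbc (by rw [_root_.compl_compl]; rintro rfl; simp at hab2) (disjoint_iff.2 e)
    have da : ∀ x y : X, Disjoint (a ⊓ x) (aᶜ ⊓ y) := fun x y =>
      disjoint_compl_right.mono inf_le_left inf_le_left
    have db : ∀ x y : X, Disjoint (x ⊓ b) (y ⊓ bᶜ) := fun x y =>
      disjoint_compl_right.mono inf_le_right inf_le_right
    have hp := two_pow_le_encard_of_pairwise_disjoint (X := X)
      (f := ![a ⊓ b, a ⊓ bᶜ, aᶜ ⊓ b, aᶜ ⊓ bᶜ]) (by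
        intro i j hij
        fin_cases i <;> fin_cases j <;>
          first
          | exact absurd rfl hij
          | exact da _ _
          | exact db _ _
          | exact (da _ _).symm
          | exact (db _ _).symm) (by
        intro i
        fin_cases i
        exacts [n1, n2, n3, n4])
    have := hp.trans hcard
    norm_num at this
  obtain ⟨x, y, hd, hx, hy, hxy⟩ := key
  have ht := hi.isTriad hd rfl
  have hi0 : ∀ x, x ≠ ⊥ → i x ≠ ⊥ := fun x hx e => hx (hinj (e.trans hbot.symm))
  refine ⟨_, _, _, ht, (Set.Finite.eq_of_subset_of_encard_le ?_
    (h.tri_subset (hmem _) (hmem _) (hmem _)) ?_).symm⟩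
  · exact (Set.finite_of_encard_le_coe (k := 8) hB).subset
      (h.tri_subset (hmem _) (hmem _) (hmem _))
  · rw [tri_encard ht (hi0 _ hx) (hi0 _ hy) (hi0 _ (by simpa [← compl_sup] using hxy))]
    exact hB

theorem _root_.IsBooleanSubalgebra.exists_pt (h : IsBooleanSubalgebra B)
    (hB : B.encard = 4) : ∃ a, pt a ≠ pt ⊥ ∧ B = pt a := by
  have hlt : ¬ B ⊆ pt ⊥ := by
    intro hs
    have h1 := Set.encard_le_encard hs
    have h2 : (pt (⊥ : A)).encard ≤ 2 := by
      have : pt (⊥ : A) = {⊥, ⊤} := Set.ext fun x => mem_pt_bot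
      rw [this]
      exact Set.encard_insert_le _ _ |>.trans (by rw [Set.encard_singleton]; rfl)
    rw [hB] at h1
    exact absurd (h1.trans h2) (by norm_num)
  obtain ⟨a, haB, ha⟩ := Set.not_subset.1 hlt
  have ha' : pt a ≠ pt ⊥ := fun e => ha (e ▸ self_mem_pt)
  refine ⟨a, ha', (Set.Finite.eq_of_subset_of_encard_le ?_ (h.pt_subset haB) ?_).symm⟩
  · exact (Set.finite_of_encard_le_coe (k := 4) hB.le).subset (h.pt_subset haB)
  · rw [pt_encard ha', hB]

end OrthomodularPoset

/-! ### Points and lines of the geometry of an orthomodular poset. -/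

namespace OrthomodularPoset

section Geometry

variable {A : OMP.{u}} {a b c d x y z : A}

theorem _root_.FourElementSubalgebra.exists_pt (P : FourElementSubalgebra A) :
    ∃ a : A, pt a ≠ pt ⊥ ∧ P.1 = pt a :=
  P.2.1.exists_pt P.2.2

theorem _root_.FourElementSubalgebra.ne_pt_bot (P : FourElementSubalgebra A) : P.1 ≠ pt ⊥ := by
  obtain ⟨a, h, h'⟩ := P.exists_pt
  rwa [h']

theorem _root_.FourElementSubalgebra.ne_bot {P : FourElementSubalgebra A} (h : P.1 = pt a) :
    a ≠ ⊥ :=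
  ne_bot_of_pt (h ▸ P.ne_pt_bot)

theorem _root_.FourElementSubalgebra.ext_iff {P Q : FourElementSubalgebra A} :
    P = Q ↔ P.1 = Q.1 :=
  Subtype.ext_iff

/-- The point spanned by an element. -/
def mkPt (a : A) (h : pt a ≠ pt ⊥) : FourElementSubalgebra A :=
  ⟨pt a, isBooleanSubalgebra_pt a, pt_encard h⟩

theorem pt_ne_pt_bot (h1 : a ≠ ⊥) (h2 : a ≠ ⊤) : pt a ≠ pt ⊥ := fun h =>
  (pt_eq_bot_iff.1 h).elim h1 h2

theorem IsTriad.pt_ne_pt_bot (h : IsTriad a b c) (ha : a ≠ ⊥) (hb : b ≠ ⊥) : pt a ≠ pt ⊥ :=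
  OrthomodularPoset.pt_ne_pt_bot ha (h.ne_top hb)

theorem tri_swap : tri a b c = tri b a c := by
  simp only [tri_eq_union, Set.union_comm (pt a)]

theorem tri_rotate : tri a b c = tri b c a := by
  simp only [tri_eq_union]
  rw [Set.union_assoc, Set.union_comm]

theorem _root_.FourElementSubalgebra.subset_tri_iff (P : FourElementSubalgebra A) :
    P.1 ⊆ tri a b c ↔ P.1 = pt a ∨ P.1 = pt b ∨ P.1 = pt c := by
  obtain ⟨x, hx, hP⟩ := P.exists_pt
  rw [hP]
  constructor
  · intro h
    have hxm := h self_mem_pt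
    rw [tri_eq_union] at hxm
    have key : ∀ {y : A}, x ∈ pt y → pt x = pt y := by
      rintro y (rfl | rfl | rfl | rfl)
      · exact absurd rfl hx
      · exact absurd pt_top hx
      · rfl
      · exact pt_compl
    rcases hxm with (h | h) | h
    exacts [.inl (key h), .inr (.inl (key h)), .inr (.inr (key h))]
  · rw [tri_eq_union]
    rintro (h | h | h) <;> rw [h]
    exacts [fun y hy => .inl (.inl hy), fun y hy => .inl (.inr hy), fun y hy => .inr hy]

/-- The sets of points contained in an eight-element Boolean subalgebra. -/
def subalgebraLines (A : OMP.{u}) : Set (Set (FourElementSubalgebra A)) :=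
  {l | ∃ C : Set A, IsBooleanSubalgebra C ∧ C.encard = 8 ∧ l = {B | B.1 ⊆ C}}

variable {l m : Set (FourElementSubalgebra A)} {P Q R : FourElementSubalgebra A}

theorem exists_of_mem_subalgebraLines (h : l ∈ subalgebraLines A) :
    ∃ a b c : A, IsTriad a b c ∧ a ≠ ⊥ ∧ b ≠ ⊥ ∧ c ≠ ⊥ ∧ l = {B | B.1 ⊆ tri a b c} := by
  obtain ⟨C, hC, h8, rfl⟩ := h
  obtain ⟨a, b, c, habc, rfl⟩ := hC.exists_triad h8.le
  have key : ∀ {a b c : A}, IsTriad a b c → a = ⊥ → (tri a b c).encard ≠ 8 := by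
    rintro a b c h rfl h8
    rw [isTriad_bot_iff'.1 h, tri_rotate, tri_bot] at h8
    have := pt_encard_le (a := b)
    rw [h8] at this
    norm_num at this
  refine ⟨a, b, c, habc, fun h => key habc h h8, fun h => key habc.rotate h ?_,
    fun h => key habc.rotate' h ?_, rfl⟩
  · rwa [← tri_rotate]
  · rwa [← tri_rotate, ← tri_rotate]

theorem exists_of_mem_subalgebraLines' (h : l ∈ subalgebraLines A) (hPQ : P ≠ Q) (hP : P ∈ l)
    (hQ : Q ∈ l) : ∃ a b c : A, IsTriad a b c ∧ a ≠ ⊥ ∧ b ≠ ⊥ ∧ c ≠ ⊥ ∧ P.1 = pt a ∧ Q.1 = pt b ∧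
      l = {B | B.1 ⊆ tri a b c} := by
  obtain ⟨a, b, c, habc, ha, hb, hc, rfl⟩ := exists_of_mem_subalgebraLines h
  have hPQ' : P.1 ≠ Q.1 := fun h => hPQ (Subtype.ext h)
  have r1 : tri b c a = tri a b c := tri_rotate.symm
  have r2 : tri c a b = tri a b c := tri_rotate
  have r3 : tri a c b = tri a b c := tri_swap.trans r2
  have r4 : tri c b a = tri a b c := tri_swap.trans r1
  rcases P.subset_tri_iff.1 hP with h1 | h1 | h1 <;>
    rcases Q.subset_tri_iff.1 hQ with h2 | h2 | h2
  · exact absurd (h1.trans h2.symm) hPQ'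
  · exact ⟨a, b, c, habc, ha, hb, hc, h1, h2, rfl⟩
  · exact ⟨a, c, b, habc.rotate'.swap, ha, hc, hb, h1, h2, by rw [r3]⟩
  · exact ⟨b, a, c, habc.swap, hb, ha, hc, h1, h2, by rw [tri_swap]⟩
  · exact absurd (h1.trans h2.symm) hPQ'
  · exact ⟨b, c, a, habc.rotate, hb, hc, ha, h1, h2, by rw [r1]⟩
  · exact ⟨c, a, b, habc.rotate', hc, ha, hb, h1, h2, by rw [r2]⟩
  · exact ⟨c, b, a, habc.swap.rotate', hc, hb, ha, h1, h2, by rw [r4]⟩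
  · exact absurd (h1.trans h2.symm) hPQ'

theorem setOf_subset_tri (hP : P.1 = pt a) (hQ : Q.1 = pt b) (hR : R.1 = pt c) :
    {B : FourElementSubalgebra A | B.1 ⊆ tri a b c} = {P, Q, R} := by
  ext B
  change B.1 ⊆ tri a b c ↔ _
  rw [B.subset_tri_iff, ← hP, ← hQ, ← hR]
  simp only [Set.mem_insert_iff, Set.mem_singleton_iff, FourElementSubalgebra.ext_iff]

theorem IsTriad.mem_subalgebraLines (h : IsTriad a b c) (hP : P.1 = pt a) (hQ : Q.1 = pt b)
    (hR : R.1 = pt c) : {P, Q, R} ∈ subalgebraLines A :=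
  ⟨tri a b c, h.isBooleanSubalgebra_tri,
    tri_encard h (P.ne_bot hP) (Q.ne_bot hQ) (R.ne_bot hR), (setOf_subset_tri hP hQ hR).symm⟩

theorem exists_eq_of_triad (h : IsTriad a b c) (ha : a ≠ ⊥) (hb : b ≠ ⊥) (hc : c ≠ ⊥) :
    ∃ P Q R : FourElementSubalgebra A, P.1 = pt a ∧ Q.1 = pt b ∧ R.1 = pt c :=
  ⟨mkPt a (h.pt_ne_pt_bot ha hb), mkPt b (h.rotate.pt_ne_pt_bot hb hc),
    mkPt c (h.rotate'.pt_ne_pt_bot hc ha), rfl, rfl, rfl⟩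

theorem encard_of_mem_subalgebraLines (h : l ∈ subalgebraLines A) : l.encard = 3 := by
  obtain ⟨a, b, c, habc, ha, hb, hc, rfl⟩ := exists_of_mem_subalgebraLines h
  obtain ⟨P, Q, R, hP, hQ, hR⟩ := exists_eq_of_triad habc ha hb hc
  rw [setOf_subset_tri hP hQ hR, Set.encard_eq_three]
  refine ⟨P, Q, R, ?_, ?_, ?_, rfl⟩ <;> rw [Ne, FourElementSubalgebra.ext_iff]
  · rw [hP, hQ]
    exact habc.pt_ne ha hc
  · rw [hP, hR]
    exact habc.swap.rotate.pt_ne ha hb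
  · rw [hQ, hR]
    exact habc.rotate.pt_ne hb ha

/-- The pre-orthogeometry of the four-element and eight-element Boolean subalgebras. -/
abbrev subalgebraGeometry (A : OMP.{u}) : PreOrthogeometry.{u} where
  Point := FourElementSubalgebra A
  lines := subalgebraLines A
  encard_line _ h := encard_of_mem_subalgebraLines h
  line_unique l hl m hm P Q hPQ hPl hQl hPm hQm := by
    obtain ⟨a, b, c, habc, ha, hb, hc, hP, hQ, rfl⟩ :=
      exists_of_mem_subalgebraLines' hl hPQ hPl hQl
    obtain ⟨x, y, z, hxyz, -, -, -, hP', hQ', rfl⟩ :=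
      exists_of_mem_subalgebraLines' hm hPQ hPm hQm
    obtain ⟨rfl, rfl, rfl⟩ := habc.eq_of_pt_eq hxyz ha hb hc (hP.symm.trans hP')
      (hQ.symm.trans hQ')
    rfl

theorem _root_.PreOrthogeometry.ne_of_line {G : PreOrthogeometry.{u}} {p q r : G.Point}
    (h : {p, q, r} ∈ G.lines) : p ≠ q ∧ p ≠ r ∧ q ≠ r := by
  have h3 := G.encard_line _ h
  have h2 : ∀ p q : G.Point, ({p, q} : Set G.Point).encard ≠ 3 := by
    intro p q h
    have := Set.encard_insert_le {q} p
    rw [h, Set.encard_singleton] at this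
    norm_num at this
  refine ⟨?_, ?_, ?_⟩ <;> rintro rfl
  · rw [Set.insert_eq_of_mem (by simp)] at h3
    exact h2 _ _ h3
  · rw [Set.insert_comm, Set.pair_eq_singleton] at h3
    exact h2 _ _ h3
  · rw [Set.insert_eq_of_mem (by simp : q ∈ ({q} : Set G.Point))] at h3
    exact h2 _ _ h3

theorem mem_subalgebraLines_iff : {P, Q, R} ∈ subalgebraLines A ↔
    ∃ a b c : A, IsTriad a b c ∧ P.1 = pt a ∧ Q.1 = pt b ∧ R.1 = pt c := by
  constructor
  · intro h
    obtain ⟨h1, h2, h3⟩ := PreOrthogeometry.ne_of_line (G := subalgebraGeometry A) h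
    obtain ⟨a, b, c, habc, ha, hb, hc, hP, hQ, hl⟩ :=
      exists_of_mem_subalgebraLines' (P := P) (Q := Q) h h1 (by simp) (by simp)
    have hR : R ∈ ({P, Q, R} : Set (FourElementSubalgebra A)) := by simp
    rw [hl] at hR
    rcases R.subset_tri_iff.1 hR with h | h | h
    · exact absurd (Subtype.ext (hP.trans h.symm)) h2
    · exact absurd (Subtype.ext (hQ.trans h.symm)) h3
    · exact ⟨a, b, c, habc, hP, hQ, h⟩
  · rintro ⟨a, b, c, h, hP, hQ, hR⟩
    exact h.mem_subalgebraLines hP hQ hR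

end Geometry

end OrthomodularPoset

/-! ### Planes in a pre-orthogeometry. -/

namespace PreOrthogeometry

variable {G : PreOrthogeometry.{u}} {a b c d u v w p q : G.Point} {l : Set G.Point}

theorem two_le_encard_inter {S : Set G.Point} (hpq : p ≠ q) (hp : p ∈ l) (hq : q ∈ l) (hpS : p ∈ S)
    (hqS : q ∈ S) : 2 ≤ (l ∩ S).encard := by
  rw [← Set.encard_pair hpq]
  refine Set.encard_le_encard ?_
  rintro x (rfl | rfl)
  exacts [⟨hp, hpS⟩, ⟨hq, hqS⟩]

theorem IsPlane.nodup (h : G.IsPlane a b c d u v w) :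
    (a ≠ b ∧ a ≠ c ∧ a ≠ d ∧ a ≠ u ∧ a ≠ v ∧ a ≠ w) ∧ (b ≠ c ∧ b ≠ d ∧ b ≠ u ∧ b ≠ v ∧ b ≠ w) ∧
      (c ≠ d ∧ c ≠ u ∧ c ≠ v ∧ c ≠ w) ∧ (d ≠ u ∧ d ≠ v ∧ d ≠ w) ∧ (u ≠ v ∧ u ≠ w) ∧ v ≠ w := by
  simpa using h.distinct

/-- A line through two midpoints would be one of the six lines of the plane, each of which has only
one midpoint. -/
theorem IsPlane.not_mem (h : G.IsPlane a b c d u v w) (hl : l ∈ G.lines) :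
    ¬ (u ∈ l ∧ v ∈ l) ∧ ¬ (u ∈ l ∧ w ∈ l) ∧ ¬ (v ∈ l ∧ w ∈ l) := by
  obtain ⟨⟨-, -, -, h1, h2, h3⟩, ⟨-, -, h4, h5, h6⟩, ⟨-, h7, h8, h9⟩, ⟨h10, h11, h12⟩,
    ⟨h13, h14⟩, h15⟩ := h.nodup
  have key : ∀ {p q}, p ≠ q → p ∈ ({a, b, c, d, u, v, w} : Set G.Point) →
      q ∈ ({a, b, c, d, u, v, w} : Set G.Point) → p ∈ l → q ∈ l →
      l ∈ ({{a, b, u}, {c, d, u}, {a, c, v}, {b, d, v}, {a, d, w}, {b, c, w}} :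
        Set (Set G.Point)) := by
    intro p q hpq hp hq hpl hql
    rw [← h.lines_eq]
    exact ⟨hl, two_le_encard_inter hpq hpl hql hp hq⟩
  refine ⟨fun ⟨hu, hv⟩ => ?_, fun ⟨hu, hv⟩ => ?_, fun ⟨hu, hv⟩ => ?_⟩
  · rcases key h13 (by simp) (by simp) hu hv with rfl | rfl | rfl | rfl | rfl | rfl <;>
      simp_all [eq_comm]
  · rcases key h14 (by simp) (by simp) hu hv with rfl | rfl | rfl | rfl | rfl | rfl <;>
      simp_all [eq_comm]
  · rcases key h15 (by simp) (by simp) hu hv with rfl | rfl | rfl | rfl | rfl | rfl <;>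
      simp_all [eq_comm]

theorem IsPlane.lines (h : G.IsPlane a b c d u v w) :
    {a, b, u} ∈ G.lines ∧ {c, d, u} ∈ G.lines ∧ {a, c, v} ∈ G.lines ∧ {b, d, v} ∈ G.lines ∧
      {a, d, w} ∈ G.lines ∧ {b, c, w} ∈ G.lines := by
  have key : ∀ l ∈ ({{a, b, u}, {c, d, u}, {a, c, v}, {b, d, v}, {a, d, w}, {b, c, w}} :
      Set (Set G.Point)), l ∈ G.lines := fun l hl => by
    rw [← h.lines_eq] at hl
    exact hl.1
  refine ⟨key _ ?_, key _ ?_, key _ ?_, key _ ?_, key _ ?_, key _ ?_⟩ <;> simp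

/-- Of the 21 pairs of points, 18 lie on the six given lines, which are then the only lines through
them. Only the three pairs of midpoints need hypotheses. -/
theorem isPlane_of_lines (h1 : {a, b, u} ∈ G.lines) (h2 : {c, d, u} ∈ G.lines)
    (h3 : {a, c, v} ∈ G.lines) (h4 : {b, d, v} ∈ G.lines) (h5 : {a, d, w} ∈ G.lines) (h6 : {b, c, w} ∈ G.lines)
    (nuv : u ≠ v) (nuw : u ≠ w) (nvw : v ≠ w)
    (huv : ∀ l ∈ G.lines, u ∈ l → v ∉ l) (huw : ∀ l ∈ G.lines, u ∈ l → w ∉ l)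
    (hvw : ∀ l ∈ G.lines, v ∈ l → w ∉ l) : G.IsPlane a b c d u v w := by
  have hd : [a, b, c, d, u, v, w].Nodup := by
    obtain ⟨ab, au, bu⟩ := ne_of_line h1
    obtain ⟨cd, cu, du⟩ := ne_of_line h2
    obtain ⟨ac, av, cv⟩ := ne_of_line h3
    obtain ⟨bd, bv, dv⟩ := ne_of_line h4
    obtain ⟨ad, aw, dw⟩ := ne_of_line h5
    obtain ⟨bc, bw, cw⟩ := ne_of_line h6
    simp only [List.nodup_cons, List.mem_cons, List.not_mem_nil, not_or, or_false,
      not_false_eq_true, List.nodup_nil, and_true]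
    exact ⟨⟨ab, ac, ad, au, av, aw⟩, ⟨bc, bd, bu, bv, bw⟩, ⟨cd, cu, cv, cw⟩, ⟨du, dv, dw⟩,
      ⟨nuv, nuw⟩, nvw⟩
  have key : ∀ l ∈ G.lines, ∀ p q, p ≠ q → p ∈ l → q ∈ l →
      p ∈ ({a, b, c, d, u, v, w} : Set G.Point) → q ∈ ({a, b, c, d, u, v, w} : Set G.Point) →
      l ∈ ({{a, b, u}, {c, d, u}, {a, c, v}, {b, d, v}, {a, d, w}, {b, c, w}} :
        Set (Set G.Point)) := by
    intro l hl p q hpq hp hq hpS hqS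
    have e : ∀ {m : Set G.Point}, m ∈ G.lines → p ∈ m → q ∈ m → l = m := fun hm hpm hqm =>
      G.line_unique l hl _ hm p q hpq hp hq hpm hqm
    have e1 := e h1
    have e2 := e h2
    have e3 := e h3
    have e4 := e h4
    have e5 := e h5
    have e6 := e h6
    have f1 := huv l hl
    have f2 := huw l hl
    have f3 := hvw l hl
    clear e h1 h2 h3 h4 h5 h6 huv huw hvw hd
    simp only [Set.mem_insert_iff, Set.mem_singleton_iff] at hpS hqS e1 e2 e3 e4 e5 e6 ⊢
    rcases hpS with rfl | rfl | rfl | rfl | rfl | rfl | rfl <;>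
      rcases hqS with rfl | rfl | rfl | rfl | rfl | rfl | rfl <;>
      first
      | exact absurd rfl hpq
      | exact absurd hq (f1 hp)
      | exact absurd hq (f2 hp)
      | exact absurd hq (f3 hp)
      | exact absurd hp (f1 hq)
      | exact absurd hp (f2 hq)
      | exact absurd hp (f3 hq)
      | exact .inl (e1 (by simp) (by simp))
      | exact .inr (.inl (e2 (by simp) (by simp)))
      | exact .inr (.inr (.inl (e3 (by simp) (by simp))))
      | exact .inr (.inr (.inr (.inl (e4 (by simp) (by simp)))))
      | exact .inr (.inr (.inr (.inr (.inl (e5 (by simp) (by simp))))))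
      | exact .inr (.inr (.inr (.inr (.inr (e6 (by simp) (by simp))))))
  have hall : ∀ l ∈ ({{a, b, u}, {c, d, u}, {a, c, v}, {b, d, v}, {a, d, w}, {b, c, w}} :
      Set (Set G.Point)), l ∈ G.lines ∧ l ⊆ {a, b, c, d, u, v, w} := by
    rintro l (rfl | rfl | rfl | rfl | rfl | rfl)
    · exact ⟨h1, by rintro x (rfl | rfl | rfl) <;> simp⟩
    · exact ⟨h2, by rintro x (rfl | rfl | rfl) <;> simp⟩
    · exact ⟨h3, by rintro x (rfl | rfl | rfl) <;> simp⟩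
    · exact ⟨h4, by rintro x (rfl | rfl | rfl) <;> simp⟩
    · exact ⟨h5, by rintro x (rfl | rfl | rfl) <;> simp⟩
    · exact ⟨h6, by rintro x (rfl | rfl | rfl) <;> simp⟩
  refine ⟨hd, fun l hl p hp q hq hpq hpS hqS => ?_, ?_⟩
  · exact (hall l (key l hl p q hpq hp hq hpS hqS)).2
  · ext l
    constructor
    · rintro ⟨hl, h2⟩
      obtain ⟨p, hp, q, hq, hpq⟩ := Set.one_lt_encard_iff_nontrivial.1
        (lt_of_lt_of_le (by norm_num) h2)
      exact key l hl p q hpq hp.1 hq.1 hp.2 hq.2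
    · intro hl
      obtain ⟨h, h'⟩ := hall l hl
      refine ⟨h, ?_⟩
      rw [Set.inter_eq_left.2 h', G.encard_line l h]
      norm_num

end PreOrthogeometry

/-! ### Planes are tetrads of nonzero elements. -/

namespace OrthomodularPoset

variable {A : OMP.{u}} {P Q R S U V W : FourElementSubalgebra A}

/-- If the two lines used their common point on opposite sides, then c ≤ aᶜ = x ≤ zᶜ. -/
theorem IsTriad.eq_of_pt_eq_of_not_le {a b c x y z : A} (h : IsTriad a b c) (h' : IsTriad x y z)
    (hx : pt a = pt x) (hcz : ¬ c ≤ zᶜ) : a = x := by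
  rcases pt_eq_iff.1 hx with rfl | rfl
  · rfl
  · refine absurd ?_ hcz
    refine h.rotate'.1.trans ?_
    simpa using h'.le₁₃

/-- Orthogonal elements of different points complete to a triad of nonzero elements, hence to a
line. -/
theorem not_le_compl_of_no_line {c z : A} (hP : P.1 = pt c) (hQ : Q.1 = pt z) (hPQ : P ≠ Q)
    (h : ∀ l ∈ subalgebraLines A, ¬ (P ∈ l ∧ Q ∈ l)) : ¬ c ≤ zᶜ := by
  intro hcz
  obtain ⟨r, hr⟩ := exists_isTriad hcz
  have hr0 : r ≠ ⊥ := by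
    rintro rfl
    rw [isTriad_bot_iff.1 hr, pt_compl] at hQ
    exact hPQ (Subtype.ext (hP.trans hQ.symm))
  have hc := P.ne_bot hP
  exact h _ (hr.mem_subalgebraLines hP hQ
    (R := mkPt r (hr.rotate'.pt_ne_pt_bot hr0 hc)) rfl) (by simp)

theorem IsTetrad.isPlane {a b c d u v w : A} (h : IsTetrad a b c d u v w) (hP : P.1 = pt a)
    (hQ : Q.1 = pt b) (hR : R.1 = pt c) (hS : S.1 = pt d) (hU : U.1 = pt u) (hV : V.1 = pt v)
    (hW : W.1 = pt w) : (subalgebraGeometry A).IsPlane P Q R S U V W := by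
  have hU' : U.1 = pt uᶜ := by rwa [pt_compl]
  have hV' : V.1 = pt vᶜ := by rwa [pt_compl]
  have hW' : W.1 = pt wᶜ := by rwa [pt_compl]
  have l1 := h.ab.mem_subalgebraLines hP hQ hU
  have l2 := h.cd.mem_subalgebraLines hR hS hU'
  have l3 := h.ac.mem_subalgebraLines hP hR hV
  have l4 := h.bd.mem_subalgebraLines hQ hS hV'
  have l5 := h.ad.mem_subalgebraLines hP hS hW
  have l6 := h.bc.mem_subalgebraLines hQ hR hW'
  have ha := P.ne_bot hP
  have hb := Q.ne_bot hQ
  have hc := R.ne_bot hR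
  have hd := S.ne_bot hS
  -- the middle points are pairwise distinct and not joined by a line
  have key : ∀ {a b c d u v w : A}, IsTetrad a b c d u v w → a ≠ ⊥ → b ≠ ⊥ → c ≠ ⊥ → d ≠ ⊥ →
      ¬ u ≤ vᶜ ∧ ¬ uᶜ ≤ v ∧ ¬ u ≤ v ∧ ¬ uᶜ ≤ vᶜ := by
    intro a b c d u v w h ha hb hc hd
    refine ⟨fun hl => hd ?_, fun hl => ha ?_, fun hl => hc ?_, fun hl => hb ?_⟩
    · refine eq_bot_of_le_of_le_compl (b := u) (by simpa using h.cd.le₂₃) ?_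
      exact le_compl_comm' (hl.trans (compl_le_compl' (by simpa using h.bd.le₂₃)))
    · refine eq_bot_of_le_of_le_compl (b := uᶜ) h.ab.le₁₃ ?_
      exact le_compl_comm' (hl.trans h.ac.rotate'.1)
    · refine eq_bot_of_le_of_le_compl (b := u) (by simpa using h.cd.le₁₃) ?_
      exact le_compl_comm' (hl.trans (le_compl_comm' h.ac.le₂₃))
    · refine eq_bot_of_le_of_le_compl (b := uᶜ) h.ab.le₂₃ ?_
      exact le_compl_comm' (hl.trans h.bd.rotate'.1)
  have nol : ∀ {u v : A} {U V : FourElementSubalgebra A}, U.1 = pt u → V.1 = pt v →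
      ¬ u ≤ vᶜ ∧ ¬ uᶜ ≤ v ∧ ¬ u ≤ v ∧ ¬ uᶜ ≤ vᶜ →
      U ≠ V ∧ ∀ l ∈ subalgebraLines A, U ∈ l → V ∉ l := by
    intro u v U V hU hV ⟨h1, h2, h3, h4⟩
    have hUV : U ≠ V := by
      rintro rfl
      rcases pt_eq_iff.1 (hU.symm.trans hV) with rfl | rfl
      · exact h3 le_rfl
      · exact h1 le_rfl
    refine ⟨hUV, fun l hl hUl hVl => ?_⟩
    obtain ⟨x, y, z, hxyz, -, -, -, hx, hy, -⟩ := exists_of_mem_subalgebraLines' hl hUV hUl hVl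
    have hxy := hxyz.1
    rcases pt_eq_iff.1 (hU.symm.trans hx) with rfl | rfl <;>
      rcases pt_eq_iff.1 (hV.symm.trans hy) with rfl | rfl
    · exact h1 hxy
    · exact h3 (by simpa using hxy)
    · exact h4 (by simpa using hxy)
    · exact h2 (by simpa using hxy)
  -- Permuting the four parts permutes the midpoints, so one computation covers all three pairs of
  -- midpoints.
  have h2 : IsTetrad a b d c u w v := ⟨h.ab, h.cd.swap, h.ad, h.bc, h.ac, h.bd⟩
  have h3 : IsTetrad a c d b v w u := ⟨h.ac, h.bd.swap, h.ad, h.bc.swap, h.ab, h.cd⟩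
  obtain ⟨huv, huv'⟩ := nol hU hV (key h ha hb hc hd)
  obtain ⟨huw, huw'⟩ := nol hU hW (key h2 ha hb hd hc)
  obtain ⟨hvw, hvw'⟩ := nol hV hW (key h3 ha hc hd hb)
  exact PreOrthogeometry.isPlane_of_lines l1 l2 l3 l4 l5 l6 huv huw hvw huv' huw' hvw'

/-- Each of the six lines comes with its own choice of elements. As midpoints are not collinear, the
third elements of two lines through a corner are not orthogonal, which forces both lines to use the
same element at that corner. -/
theorem exists_isTetrad_of_isPlane (h : (subalgebraGeometry A).IsPlane P Q R S U V W) :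
    ∃ a b c d u v w : A, IsTetrad a b c d u v w ∧ P.1 = pt a ∧ Q.1 = pt b ∧ R.1 = pt c ∧
      S.1 = pt d ∧ U.1 = pt u ∧ V.1 = pt v ∧ W.1 = pt w := by
  obtain ⟨l1, l2, l3, l4, l5, l6⟩ := h.lines
  obtain ⟨-, -, -, -, ⟨UV, UW⟩, VW⟩ := h.nodup
  have nUV : ∀ l ∈ subalgebraLines A, ¬ (U ∈ l ∧ V ∈ l) := fun l hl => (h.not_mem hl).1
  have nUW : ∀ l ∈ subalgebraLines A, ¬ (U ∈ l ∧ W ∈ l) := fun l hl => (h.not_mem hl).2.1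
  have nVW : ∀ l ∈ subalgebraLines A, ¬ (V ∈ l ∧ W ∈ l) := fun l hl => (h.not_mem hl).2.2
  obtain ⟨a, b, u, t1, hP, hQ, hU⟩ := mem_subalgebraLines_iff.1 l1
  obtain ⟨c, d, u', t2, hR, hS, hU'⟩ := mem_subalgebraLines_iff.1 l2
  obtain ⟨a₁, c₁, v, t3, hP₁, hR₁, hV⟩ := mem_subalgebraLines_iff.1 l3
  obtain ⟨b₁, d₁, v', t4, hQ₁, hS₁, hV'⟩ := mem_subalgebraLines_iff.1 l4
  obtain ⟨a₂, d₂, w, t5, hP₂, hS₂, hW⟩ := mem_subalgebraLines_iff.1 l5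
  obtain ⟨b₂, c₂, w', t6, hQ₂, hR₂, hW'⟩ := mem_subalgebraLines_iff.1 l6
  obtain rfl := t1.eq_of_pt_eq_of_not_le t3 (hP.symm.trans hP₁)
    (not_le_compl_of_no_line hU hV UV nUV)
  obtain rfl := t1.eq_of_pt_eq_of_not_le t5 (hP.symm.trans hP₂)
    (not_le_compl_of_no_line hU hW UW nUW)
  obtain rfl := t1.swap.eq_of_pt_eq_of_not_le t4 (hQ.symm.trans hQ₁)
    (not_le_compl_of_no_line hU hV' UV nUV)
  obtain rfl := t1.swap.eq_of_pt_eq_of_not_le t6 (hQ.symm.trans hQ₂)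
    (not_le_compl_of_no_line hU hW' UW nUW)
  obtain rfl := t2.eq_of_pt_eq_of_not_le t3.swap (hR.symm.trans hR₁)
    (not_le_compl_of_no_line hU' hV UV nUV)
  obtain rfl := t2.eq_of_pt_eq_of_not_le t6.swap (hR.symm.trans hR₂)
    (not_le_compl_of_no_line hU' hW' UW nUW)
  obtain rfl := t2.swap.eq_of_pt_eq_of_not_le t4.swap (hS.symm.trans hS₁)
    (not_le_compl_of_no_line hU' hV' UV nUV)
  obtain rfl := t2.swap.eq_of_pt_eq_of_not_le t5.swap (hS.symm.trans hS₂)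
    (not_le_compl_of_no_line hU' hW UW nUW)
  -- If both lines through the midpoint used it on the same side, then c ⊕ d = uᶜ would be
  -- orthogonal to a, although a lies below uᶜ.
  have hu : u' = uᶜ := by
    rcases pt_eq_iff.1 (hU'.symm.trans hU) with rfl | rfl
    · refine absurd (eq_bot_of_le_of_le_compl (b := u'ᶜ) t1.le₁₃ ?_) (P.ne_bot hP)
      exact le_compl_comm' (t2.compl_le (le_compl_comm' t3.1) (le_compl_comm' t5.1))
    · rfl
  subst hu
  obtain ⟨v₁, w₁, ht⟩ := t1.exists_isTetrad t2
  rw [← t3.unique ht.ac, ← t5.unique ht.ad] at ht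
  exact ⟨a, b, c, d, u, v, w, ht, hP, hQ, hR, hS, hU, hV, hW⟩

end OrthomodularPoset

/-! ### Morphisms of orthomodular posets and the functor. -/

namespace OMP.Hom

open OrthomodularPoset

variable {A B : OMP.{u}} (f : OMP.Hom A B) {a b c : A}

theorem map_bot : f.toFun ⊥ = ⊥ := by
  have h : IsOrthosum (⊤ : A) ⊥ ⊤ := by
    rw [isOrthosum_iff_isTriad, compl_top']
    exact isTriad_bot_iff.2 (by simp)
  have := (f.map_orthosum _ _ _ h).1
  rw [f.map_top] at this
  simpa using le_compl_comm' this

theorem map_compl (a : A) : f.toFun aᶜ = (f.toFun a)ᶜ := by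
  have h : IsOrthosum a aᶜ ⊤ := by
    rw [isOrthosum_iff_isTriad, compl_top']
    exact isTriad_bot a
  have := f.map_orthosum _ _ _ h
  rw [f.map_top, isOrthosum_iff_isTriad, compl_top'] at this
  exact isTriad_bot_iff.1 this

theorem map_isTriad (h : IsTriad a b c) : IsTriad (f.toFun a) (f.toFun b) (f.toFun c) := by
  have := f.map_orthosum _ _ _ h
  rwa [map_compl] at this

theorem image_pt (a : A) : f.toFun '' pt a = pt (f.toFun a) := by
  simp only [pt, Set.image_insert_eq, Set.image_singleton, map_bot, f.map_top, map_compl]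

/-- A map that preserves `⊥`, complements, and triads is a morphism. -/
def ofIsTriad (f : A → B) (h0 : f ⊥ = ⊥) (hc : ∀ a, f aᶜ = (f a)ᶜ)
    (h : ∀ a b c, IsTriad a b c → IsTriad (f a) (f b) (f c)) : OMP.Hom A B where
  toFun := f
  map_top := by rw [← compl_bot', hc, h0, compl_bot']
  map_orthosum a b c hs := by
    rw [isOrthosum_iff_isTriad] at hs ⊢
    rw [← hc]
    exact h _ _ _ hs

end OMP.Hom

namespace OrthomodularPoset

theorem IsTriad.pt_eq_of_pt_eq_bot {A : Type u} [OrthomodularPoset A] {a b c : A}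
    (h : IsTriad a b c) (ha : pt a = pt ⊥) : pt b = pt c := by
  rcases pt_eq_bot_iff.1 ha with rfl | rfl
  · rw [isTriad_bot_iff'.1 h, pt_compl]
  · obtain ⟨rfl, rfl⟩ := h.eq_bot_of_eq_top rfl
    rfl

theorem IsTriad.pt_middle_ne {A : Type u} [OrthomodularPoset A] {a b c d u : A}
    (h : IsTriad a b u) (h' : IsTriad c d uᶜ) (ha : a ≠ ⊥) (hc : c ≠ ⊥) : pt u ≠ pt ⊥ := by
  have h0 := h'.rotate'.ne_top hc
  rw [Ne, pt_eq_bot_iff, not_or]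
  exact ⟨by simpa using h0, h.rotate'.ne_top ha⟩

variable {A B C : OMP.{u}} {P Q R : FourElementSubalgebra A}

/-- The representation of the geometry of `A` by `A`. -/
def subalgebraRepresentation (A : OMP.{u}) : (subalgebraGeometry A).Representation A where
  toEquiv := Equiv.refl _
  mem_lines_iff l := by
    change _ ↔ ∃ C : Set A, _ ∧ _ ∧ id '' l = _
    rw [Set.image_id]
    rfl

/-- The orthogeometry of an orthomodular poset. -/
abbrev orthogeometry (A : OMP.{u}) : OG.{u} where
  toPreOrthogeometry := subalgebraGeometry A
  representable := ⟨A, ⟨subalgebraRepresentation A⟩⟩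

open Classical in
/-- The partial function on four-element subalgebras given by taking images. -/
noncomputable def mapPoint (f : OMP.Hom A B) (P : FourElementSubalgebra A) :
    Option (FourElementSubalgebra B) :=
  if h : IsBooleanSubalgebra (f.toFun '' P.1) ∧ (f.toFun '' P.1).encard = 4 then
    some ⟨f.toFun '' P.1, h⟩ else none

theorem mapPoint_eq_some_iff {f : OMP.Hom A B} {Q : FourElementSubalgebra B} :
    mapPoint f P = some Q ↔ Q.1 = f.toFun '' P.1 := by
  unfold mapPoint
  constructor
  · intro h
    split_ifs at h
    rw [← Option.some.inj h]
  · intro h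
    have h' : IsBooleanSubalgebra (f.toFun '' P.1) ∧ (f.toFun '' P.1).encard = 4 := h ▸ Q.2
    rw [dif_pos h']
    congr 1
    exact FourElementSubalgebra.ext_iff.2 h.symm

theorem mapPoint_eq_some_iff' {f : OMP.Hom A B} {Q : FourElementSubalgebra B} {a : A}
    (h : P.1 = pt a) : mapPoint f P = some Q ↔ Q.1 = pt (f.toFun a) := by
  rw [mapPoint_eq_some_iff, h, f.image_pt]

theorem mapPoint_eq_none_iff {f : OMP.Hom A B} {a : A}
    (h : P.1 = pt a) : mapPoint f P = none ↔ pt (f.toFun a) = pt ⊥ := by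
  rw [Option.eq_none_iff_forall_ne_some]
  constructor
  · intro h'
    by_contra h0
    exact h' (mkPt _ h0) ((mapPoint_eq_some_iff' h).2 rfl)
  · intro h' Q hQ
    rw [mapPoint_eq_some_iff' h, h'] at hQ
    exact Q.ne_pt_bot hQ

/-- The morphism of orthogeometries given by a morphism of orthomodular posets. -/
noncomputable def orthogeometryMap (f : OMP.Hom A B) :
    OG.Hom (orthogeometry A) (orthogeometry B) where
  toFun := mapPoint f
  map_none P Q R hl hP := by
    obtain ⟨a, b, c, h, ha, hb, hc⟩ := mem_subalgebraLines_iff.1 hl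
    have h' := (f.map_isTriad h).pt_eq_of_pt_eq_bot ((mapPoint_eq_none_iff ha).1 hP)
    refine Option.ext fun S => ?_
    exact (mapPoint_eq_some_iff' hb).trans (h' ▸ (mapPoint_eq_some_iff' hc).symm)
  map_some P Q R P' Q' R' hl hP hQ hR := by
    obtain ⟨a, b, c, h, ha, hb, hc⟩ := mem_subalgebraLines_iff.1 hl
    exact (f.map_isTriad h).mem_subalgebraLines ((mapPoint_eq_some_iff' ha).1 hP)
      ((mapPoint_eq_some_iff' hb).1 hQ) ((mapPoint_eq_some_iff' hc).1 hR)
  map_plane P Q R S U V W P' Q' R' S' hpl hP hQ hR hS := by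
    obtain ⟨a, b, c, d, u, v, w, h, ha, hb, hc, hd, hu, hv, hw⟩ := exists_isTetrad_of_isPlane hpl
    have hP' := (mapPoint_eq_some_iff' ha).1 hP
    have hQ' := (mapPoint_eq_some_iff' hb).1 hQ
    have hR' := (mapPoint_eq_some_iff' hc).1 hR
    have hS' := (mapPoint_eq_some_iff' hd).1 hS
    have t : IsTetrad (f.toFun a) (f.toFun b) (f.toFun c) (f.toFun d) (f.toFun u) (f.toFun v)
        (f.toFun w) :=
      ⟨f.map_isTriad h.ab, f.map_compl u ▸ f.map_isTriad h.cd, f.map_isTriad h.ac,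
        f.map_compl v ▸ f.map_isTriad h.bd, f.map_isTriad h.ad, f.map_compl w ▸ f.map_isTriad h.bc⟩
    have ha0 := P'.ne_bot hP'
    have hc0 := R'.ne_bot hR'
    have hd0 := S'.ne_bot hS'
    have hb0 := Q'.ne_bot hQ'
    let U' := mkPt _ (t.ab.pt_middle_ne t.cd ha0 hc0)
    let V' := mkPt _ (t.ac.pt_middle_ne t.bd ha0 hb0)
    let W' := mkPt _ (t.ad.pt_middle_ne t.bc ha0 hb0)
    exact ⟨U', V', W', (mapPoint_eq_some_iff' hu).2 rfl, (mapPoint_eq_some_iff' hv).2 rfl,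
      (mapPoint_eq_some_iff' hw).2 rfl, t.isPlane hP' hQ' hR' hS' rfl rfl rfl⟩
  reflect_plane P Q R S T P' Q' R' S' T' V' W' l1 l2 hP hQ hR hS hT hpl := by
    obtain ⟨q, r, p, h1, hq, hr, hp⟩ := mem_subalgebraLines_iff.1 l1
    obtain ⟨s, t, p₁, h2, hs, ht, hp₁⟩ := mem_subalgebraLines_iff.1 l2
    have hP' := (mapPoint_eq_some_iff' hp).1 hP
    have hP₁' := (mapPoint_eq_some_iff' hp₁).1 hP
    have hQ' := (mapPoint_eq_some_iff' hq).1 hQ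
    have hR' := (mapPoint_eq_some_iff' hr).1 hR
    have hS' := (mapPoint_eq_some_iff' hs).1 hS
    have hT' := (mapPoint_eq_some_iff' ht).1 hT
    obtain ⟨a, b, c, d, u, v, w, t', ha, hb, hc, hd, hu, hv, hw⟩ := exists_isTetrad_of_isPlane hpl
    have e1 := t'.ab.eq_of_pt_eq (f.map_isTriad h1) (Q'.ne_bot ha) (R'.ne_bot hb) (P'.ne_bot hu)
      (ha.symm.trans hQ') (hb.symm.trans hR')
    have e2 := t'.cd.eq_of_pt_eq (f.map_isTriad h2) (S'.ne_bot hc) (T'.ne_bot hd)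
      (P'.ne_bot (by rwa [pt_compl])) (hc.symm.trans hS') (hd.symm.trans hT')
    -- The image plane sends the two third elements to complementary values, so they cannot be equal
    -- in A.
    have hpp : p₁ = pᶜ := by
      rcases pt_eq_iff.1 (hp₁.symm.trans hp) with rfl | rfl
      · have hu0 := P'.ne_bot hu
        refine absurd (e1.2.2.trans e2.2.2.symm) (ne_compl_self ?_)
        intro e
        exact hu0 (by rw [← le_bot_iff, e]; exact le_top)
      · rfl
    subst hpp
    obtain ⟨v, w, ht'⟩ := h1.exists_isTetrad h2
    exact ⟨mkPt _ (ht'.ac.pt_middle_ne ht'.bd (Q.ne_bot hq) (R.ne_bot hr)),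
      mkPt _ (ht'.ad.pt_middle_ne ht'.bc (Q.ne_bot hq) (R.ne_bot hr)),
      ht'.isPlane hq hr hs ht hp rfl rfl⟩

/-- The functor from orthomodular posets to orthogeometries. -/
noncomputable def orthogeometryFunctor : OMP.{u} ⥤ OG.{u} where
  obj := orthogeometry
  map f := orthogeometryMap f
  map_id A := by
    refine OG.Hom.ext (funext fun P => ?_)
    exact mapPoint_eq_some_iff.2 (Set.image_id _).symm
  map_comp {A B C} f g := by
    refine OG.Hom.ext (funext fun P => Option.ext fun Q => ?_)
    obtain ⟨a, ha, hP⟩ := FourElementSubalgebra.exists_pt P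
    change mapPoint (f ≫ g) P = some Q ↔ (mapPoint f P).bind (mapPoint g) = some Q
    refine (mapPoint_eq_some_iff' hP).trans (Iff.trans ?_ Option.bind_eq_some_iff.symm)
    constructor
    · intro h
      have hne : pt (OMP.Hom.toFun f a) ≠ pt ⊥ := by
        intro h0
        apply Q.ne_pt_bot
        rw [h]
        change pt (OMP.Hom.toFun g (OMP.Hom.toFun f a)) = pt ⊥
        rw [← OMP.Hom.image_pt, h0, OMP.Hom.image_pt, OMP.Hom.map_bot]
      exact ⟨mkPt _ hne, (mapPoint_eq_some_iff' hP).2 rfl, (mapPoint_eq_some_iff' rfl).2 h⟩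
    · rintro ⟨R, hR, hQ⟩
      exact (mapPoint_eq_some_iff' ((mapPoint_eq_some_iff' hP).1 hR)).1 hQ

/-! ### Morphisms of geometries as unoriented maps on elements. -/

/-- The map on elements that corresponds to a partial function on points, where a set `pt y` is
used in place of the orientation-free value `y`. -/
noncomputable def elemMap (α : FourElementSubalgebra A → Option (FourElementSubalgebra B))
    (a : A) : Set B :=
  open Classical in if h : pt a ≠ pt ⊥ then (α (mkPt a h)).elim (pt ⊥) Subtype.val else pt ⊥

section elemMap

variable {α : FourElementSubalgebra A → Option (FourElementSubalgebra B)} {a : A}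
  {Q : FourElementSubalgebra B}

theorem elemMap_eq (h : P.1 = pt a) : elemMap α a = (α P).elim (pt ⊥) Subtype.val := by
  have h0 : pt a ≠ pt ⊥ := h ▸ P.ne_pt_bot
  rw [elemMap, dif_pos h0]
  have : mkPt a h0 = P := FourElementSubalgebra.ext_iff.2 h.symm
  rw [this]

theorem elemMap_of_pt_eq_bot (h : pt a = pt ⊥) : elemMap α a = pt ⊥ := by
  rw [elemMap, dif_neg (not_not.2 h)]

theorem eq_some_iff_elemMap (h : P.1 = pt a) : α P = some Q ↔ elemMap α a = Q.1 := by
  rw [elemMap_eq h]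
  rcases hα : α P with _ | R
  · exact iff_of_false (by simp) Q.ne_pt_bot.symm
  · exact Option.some_inj.trans FourElementSubalgebra.ext_iff

theorem eq_none_iff_elemMap (h : P.1 = pt a) : α P = none ↔ elemMap α a = pt ⊥ := by
  rw [elemMap_eq h]
  rcases hα : α P with _ | R
  · exact iff_of_true rfl rfl
  · exact iff_of_false (by simp) R.ne_pt_bot

theorem elemMap_congr {b : A} (h : pt a = pt b) : elemMap α a = elemMap α b := by
  by_cases ha : pt a = pt ⊥
  · rw [elemMap_of_pt_eq_bot ha, elemMap_of_pt_eq_bot (h ▸ ha)]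
  · rw [elemMap_eq (P := mkPt a ha) rfl, elemMap_eq (P := mkPt a ha) h]

theorem elemMap_injective : Function.Injective (elemMap (A := A) (B := B)) := by
  intro α β h
  refine funext fun P => Option.ext fun Q => ?_
  obtain ⟨a, -, hP⟩ := P.exists_pt
  rw [eq_some_iff_elemMap hP, eq_some_iff_elemMap hP, h]

theorem exists_point_of_elemMap_ne (h : elemMap α a ≠ pt ⊥) :
    ∃ P : FourElementSubalgebra A, ∃ Q : FourElementSubalgebra B,
      P.1 = pt a ∧ α P = some Q ∧ elemMap α a = Q.1 := by
  have ha : pt a ≠ pt ⊥ := fun e => h (elemMap_of_pt_eq_bot e)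
  rcases hα : α (mkPt a ha) with _ | Q
  · exact absurd ((eq_none_iff_elemMap rfl).1 hα) h
  · exact ⟨mkPt a ha, Q, rfl, hα, (eq_some_iff_elemMap rfl).1 hα⟩

end elemMap

theorem elemMap_mapPoint (f : OMP.Hom A B) : elemMap (mapPoint f) = fun a => pt (f.toFun a) := by
  funext a
  by_cases ha : pt a = pt ⊥
  · rw [elemMap_of_pt_eq_bot ha, ← f.image_pt, ha, f.image_pt, f.map_bot]
  · have hP : (mkPt a ha).1 = pt a := rfl
    by_cases hf : pt (f.toFun a) = pt ⊥
    · rw [(eq_none_iff_elemMap hP).1 ((mapPoint_eq_none_iff hP).2 hf), hf]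
    · exact (eq_some_iff_elemMap (Q := mkPt _ hf) hP).1 ((mapPoint_eq_some_iff' hP).2 rfl)

/-- The properties, on the level of elements, of a morphism of orthogeometries between
orthomodular posets. -/
structure IsUnoriented {A B : Type u} [OrthomodularPoset A] [OrthomodularPoset B] (Φ : A → Set B) :
    Prop where
  compl : ∀ a, Φ aᶜ = Φ a
  bot : Φ ⊥ = pt ⊥
  exists_pt : ∀ a, ∃ y, Φ a = pt y
  eq_of_eq_bot : ∀ {a b c}, IsTriad a b c → Φ a = pt ⊥ → Φ b = Φ c
  triad : ∀ {a b c}, IsTriad a b c → Φ a ≠ pt ⊥ → Φ b ≠ pt ⊥ → Φ c ≠ pt ⊥ →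
    ∃ x y z, IsTriad x y z ∧ Φ a = pt x ∧ Φ b = pt y ∧ Φ c = pt z
  tetrad : ∀ {a b c d u v w}, IsTetrad a b c d u v w → Φ a ≠ pt ⊥ → Φ b ≠ pt ⊥ → Φ c ≠ pt ⊥ →
    Φ d ≠ pt ⊥ → ∃ a' b' c' d' u' v' w', IsTetrad a' b' c' d' u' v' w' ∧ Φ a = pt a' ∧
      Φ b = pt b' ∧ Φ c = pt c' ∧ Φ d = pt d' ∧ Φ u = pt u'
  -- Condition 3 in contrapositive form: two triads that use p on the same side span no plane with p
  -- as midpoint, so their images do not either.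
  reflect : ∀ {q r s t p}, IsTriad q r p → IsTriad s t p → Φ p ≠ pt ⊥ → Φ q ≠ pt ⊥ →
    Φ r ≠ pt ⊥ → Φ s ≠ pt ⊥ → Φ t ≠ pt ⊥ → ∀ {q' r' s' t' p' v' w'}, Φ q = pt q' →
      Φ r = pt r' → Φ s = pt s' → Φ t = pt t' → Φ p = pt p' → ¬ IsTetrad q' r' s' t' p' v' w'

theorem isUnoriented_elemMap (α : OG.Hom (orthogeometry A) (orthogeometry B)) :
    IsUnoriented (elemMap α.toFun) where
  compl a := elemMap_congr pt_compl
  bot := elemMap_of_pt_eq_bot rfl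
  exists_pt a := by
    by_cases h : elemMap α.toFun a = pt ⊥
    · exact ⟨⊥, h⟩
    · obtain ⟨P, Q, -, -, hQ⟩ := exists_point_of_elemMap_ne h
      obtain ⟨y, -, hy⟩ := Q.exists_pt
      exact ⟨y, hQ.trans hy⟩
  eq_of_eq_bot {a b c} h ha := by
    by_cases ha0 : a = ⊥
    · subst ha0
      exact elemMap_congr (h.pt_eq_of_pt_eq_bot rfl)
    by_cases hb0 : b = ⊥
    · subst hb0
      exact (elemMap_of_pt_eq_bot rfl).trans (ha.symm.trans
        (elemMap_congr (h.swap.pt_eq_of_pt_eq_bot rfl)))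
    by_cases hc0 : c = ⊥
    · subst hc0
      exact (elemMap_congr (h.rotate'.pt_eq_of_pt_eq_bot rfl)).symm.trans
        (ha.trans (elemMap_of_pt_eq_bot rfl).symm)
    obtain ⟨P, Q, R, hP, hQ, hR⟩ := exists_eq_of_triad h ha0 hb0 hc0
    have := α.map_none P Q R (h.mem_subalgebraLines hP hQ hR) ((eq_none_iff_elemMap hP).2 ha)
    rw [elemMap_eq hQ, elemMap_eq hR, this]
  triad {a b c} h ha hb hc := by
    obtain ⟨P, P', hP, hPα, hP'⟩ := exists_point_of_elemMap_ne ha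
    obtain ⟨Q, Q', hQ, hQα, hQ'⟩ := exists_point_of_elemMap_ne hb
    obtain ⟨R, R', hR, hRα, hR'⟩ := exists_point_of_elemMap_ne hc
    obtain ⟨x, y, z, h', hx, hy, hz⟩ := mem_subalgebraLines_iff.1
      (α.map_some _ _ _ _ _ _ (h.mem_subalgebraLines hP hQ hR) hPα hQα hRα)
    exact ⟨x, y, z, h', hP'.trans hx, hQ'.trans hy, hR'.trans hz⟩
  tetrad {a b c d u v w} h ha hb hc hd := by
    obtain ⟨P, P', hP, hPα, hP'⟩ := exists_point_of_elemMap_ne ha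
    obtain ⟨Q, Q', hQ, hQα, hQ'⟩ := exists_point_of_elemMap_ne hb
    obtain ⟨R, R', hR, hRα, hR'⟩ := exists_point_of_elemMap_ne hc
    obtain ⟨S, S', hS, hSα, hS'⟩ := exists_point_of_elemMap_ne hd
    have ha0 := P.ne_bot hP
    have hb0 := Q.ne_bot hQ
    have hc0 := R.ne_bot hR
    have hu : (mkPt u (h.ab.pt_middle_ne h.cd ha0 hc0)).1 = pt u := rfl
    obtain ⟨U', V', W', hU, hV, hW, hpl⟩ := α.map_plane _ _ _ _ _ _ _ _ _ _ _
      (h.isPlane hP hQ hR hS hu (V := mkPt v (h.ac.pt_middle_ne h.bd ha0 hb0)) rfl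
        (W := mkPt w (h.ad.pt_middle_ne h.bc ha0 hb0)) rfl) hPα hQα hRα hSα
    obtain ⟨a', b', c', d', u', v', w', h', h1, h2, h3, h4, h5, -, -⟩ :=
      exists_isTetrad_of_isPlane hpl
    exact ⟨a', b', c', d', u', v', w', h', hP'.trans h1, hQ'.trans h2, hR'.trans h3,
      hS'.trans h4, ((eq_some_iff_elemMap hu).1 hU).trans h5⟩
  reflect {q r s t p} h1 h2 hp hq hr hs ht q' r' s' t' p' v' w' eq er es et ep h := by
    obtain ⟨P, P', hP, hPα, hP'⟩ := exists_point_of_elemMap_ne hp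
    obtain ⟨Q, Q', hQ, hQα, hQ'⟩ := exists_point_of_elemMap_ne hq
    obtain ⟨R, R', hR, hRα, hR'⟩ := exists_point_of_elemMap_ne hr
    obtain ⟨S, S', hS, hSα, hS'⟩ := exists_point_of_elemMap_ne hs
    obtain ⟨T, T', hT, hTα, hT'⟩ := exists_point_of_elemMap_ne ht
    have hq0 := Q'.ne_bot (hQ'.symm.trans eq)
    have hr0 := R'.ne_bot (hR'.symm.trans er)
    obtain ⟨V, W, hpl⟩ := α.reflect_plane _ _ _ _ _ _ _ _ _ _ _ _
      (h1.mem_subalgebraLines hQ hR hP) (h2.mem_subalgebraLines hS hT hP) hPα hQα hRα hSα hTα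
      (h.isPlane (hQ'.symm.trans eq) (hR'.symm.trans er) (hS'.symm.trans es) (hT'.symm.trans et)
        (hP'.symm.trans ep) (V := mkPt v' (h.ac.pt_middle_ne h.bd hq0 hr0)) rfl
        (W := mkPt w' (h.ad.pt_middle_ne h.bc hq0 hr0)) rfl)
    obtain ⟨a, b, c, d, u, v, w, h', ha, hb, hc, hd, hu, -, -⟩ := exists_isTetrad_of_isPlane hpl
    have e1 := h1.eq_of_pt_eq h'.ab (Q.ne_bot hQ) (R.ne_bot hR) (P.ne_bot hP)
      (hQ.symm.trans ha) (hR.symm.trans hb)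
    have e2 := h2.eq_of_pt_eq h'.cd (S.ne_bot hS) (T.ne_bot hT) (P.ne_bot hP)
      (hS.symm.trans hc) (hT.symm.trans hd)
    refine absurd (e1.2.2.symm.trans e2.2.2) (ne_compl_self ?_)
    intro e
    exact P.ne_bot hP (by rw [← le_bot_iff, e]; exact le_top)

end OrthomodularPoset

/-! ### Orienting an unoriented map. -/

namespace OrthomodularPoset

variable {A B : Type u} [OrthomodularPoset A] [OrthomodularPoset B] {Φ : A → Set B} {f : A → B}
  {a b c d e q r s t p x y : A} {q' r' s' t' p' p'' z z' : B}

namespace IsUnoriented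

theorem ne_of_opposite (hΦ : IsUnoriented Φ) (h1 : IsTriad q r p) (h2 : IsTriad s t pᶜ)
    (hq : Φ q ≠ pt ⊥) (hr : Φ r ≠ pt ⊥) (hs : Φ s ≠ pt ⊥) (ht : Φ t ≠ pt ⊥) : Φ p ≠ pt ⊥ := by
  obtain ⟨v, w, h⟩ := h1.exists_isTetrad h2
  obtain ⟨a, b, c, d, u, v, w, h', ha, hb, hc, hd, hu⟩ := hΦ.tetrad h hq hr hs ht
  rw [hu]
  exact h'.ab.pt_middle_ne h'.cd (ne_bot_of_pt (ha ▸ hq)) (ne_bot_of_pt (hc ▸ hs))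

/-- The two triads form a tetrad, and condition 2 sends it to a tetrad, in which the image of p is
used on both sides. -/
theorem eq_compl_of_opposite (hΦ : IsUnoriented Φ) (h1 : IsTriad q r p) (h2 : IsTriad s t pᶜ)
    (hq : Φ q ≠ pt ⊥) (hr : Φ r ≠ pt ⊥) (hs : Φ s ≠ pt ⊥) (ht : Φ t ≠ pt ⊥)
    (h1' : IsTriad q' r' p') (h2' : IsTriad s' t' p'') (eq : Φ q = pt q') (er : Φ r = pt r')
    (es : Φ s = pt s') (et : Φ t = pt t') : p'' = p'ᶜ := by
  obtain ⟨v, w, h⟩ := h1.exists_isTetrad h2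
  obtain ⟨a, b, c, d, u, v, w, h', ha, hb, hc, hd, hu⟩ := hΦ.tetrad h hq hr hs ht
  have ha0 := ne_bot_of_pt (ha ▸ hq)
  have hb0 := ne_bot_of_pt (hb ▸ hr)
  have hc0 := ne_bot_of_pt (hc ▸ hs)
  have hd0 := ne_bot_of_pt (hd ▸ ht)
  have hu0 := h'.ab.pt_middle_ne h'.cd ha0 hc0
  have e1 := h'.ab.eq_of_pt_eq h1' ha0 hb0 (ne_bot_of_pt hu0) (ha.symm.trans eq) (hb.symm.trans er)
  have e2 := h'.cd.eq_of_pt_eq h2' hc0 hd0 (ne_bot_of_pt (by rwa [pt_compl]))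
    (hc.symm.trans es) (hd.symm.trans et)
  rw [← e1.2.2, e2.2.2]

/-- Complementary values would make the two image triads a tetrad, which condition 3 forbids. -/
theorem eq_of_same (hΦ : IsUnoriented Φ) (h1 : IsTriad q r p) (h2 : IsTriad s t p)
    (hp : Φ p ≠ pt ⊥) (hq : Φ q ≠ pt ⊥) (hr : Φ r ≠ pt ⊥) (hs : Φ s ≠ pt ⊥) (ht : Φ t ≠ pt ⊥)
    (h1' : IsTriad q' r' p') (h2' : IsTriad s' t' p'') (eq : Φ q = pt q') (er : Φ r = pt r')
    (es : Φ s = pt s') (et : Φ t = pt t') (ep : Φ p = pt p') (ep' : Φ p = pt p'') : p' = p'' := by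
  rcases pt_eq_iff.1 (ep'.symm.trans ep) with rfl | rfl
  · rfl
  · obtain ⟨v, w, h⟩ := h1'.exists_isTetrad h2'
    exact absurd h (hΦ.reflect h1 h2 hp hq hr hs ht eq er es et ep)

theorem eq_of_eq_bot' (hΦ : IsUnoriented Φ) (h : IsTriad a b cᶜ) (ha : Φ a = pt ⊥) :
    Φ b = Φ c := by
  rw [hΦ.eq_of_eq_bot h ha, hΦ.compl]

/-- If `a` is null and its complement splits into two elements `b`, `e` that are not null, then the
elements below `a` are null. -/
theorem eq_bot_of_split (hΦ : IsUnoriented Φ) (h : IsTriad b e a) (h' : IsTriad x y aᶜ)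
    (ha : Φ a = pt ⊥) (hb : Φ b ≠ pt ⊥) : Φ x = pt ⊥ := by
  by_contra hx
  have hy : Φ y = Φ x := (hΦ.eq_of_eq_bot h'.rotate' ((hΦ.compl a).trans ha)).symm
  have he : Φ e = Φ b := (hΦ.eq_of_eq_bot h.rotate' ha).symm
  exact hΦ.ne_of_opposite h h' hb (he ▸ hb) hx (hy ▸ hx) ha

end IsUnoriented

/-- The lines through the point of `a` determine the value `y` of an orientation of `Φ` at `a`. -/
inductive OrientedAt (Φ : A → Set B) : A → B → Prop
  | triad {q r a : A} {q' r' y : B} : IsTriad q r a → Φ q ≠ pt ⊥ → Φ r ≠ pt ⊥ → Φ a ≠ pt ⊥ →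
      IsTriad q' r' y → Φ q = pt q' → Φ r = pt r' → Φ a = pt y → OrientedAt Φ a y
  -- The value 1 at a would force the orthogonal element q to go to 0.
  | bot {q r a : A} : IsTriad q r a → Φ a = pt ⊥ → Φ q ≠ pt ⊥ → OrientedAt Φ a ⊥

namespace OrientedAt

theorem eq_pt (h : OrientedAt Φ a z) : Φ a = pt z := by
  cases h <;> assumption

theorem unique (hΦ : IsUnoriented Φ) (h : OrientedAt Φ a z) (h' : OrientedAt Φ a z') : z = z' := by
  cases h with
  | triad h1 hq hr ha h1' eq er ea =>
    cases h' with
    | triad h2 hs ht _ h2' es et ea' =>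
      exact hΦ.eq_of_same h1 h2 ha hq hr hs ht h1' h2' eq er es et ea ea'
    | bot _ ha' _ => exact absurd ha' ha
  | bot _ ha _ =>
    cases h' with
    | triad _ _ _ ha' => exact absurd ha ha'
    | bot => rfl

/-- For null a the rules cannot give 0 on both sides: the two witnessing triads would form a tetrad
with four non-null parts, whose midpoint a is not null by condition 2. -/
theorem compl_unique (hΦ : IsUnoriented Φ) (h : OrientedAt Φ a z) (h' : OrientedAt Φ aᶜ z') :
    z' = zᶜ := by
  have hc := hΦ.compl a
  cases h with
  | triad h1 hq hr ha h1' eq er ea =>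
    cases h' with
    | triad h2 hs ht _ h2' es et ea' =>
      exact hΦ.eq_compl_of_opposite h1 h2 hq hr hs ht h1' h2' eq er es et
    | bot _ ha' _ => exact absurd (hc.symm.trans ha') ha
  | bot h1 ha hq =>
    have hr := hΦ.eq_of_eq_bot h1.rotate' ha
    cases h' with
    | triad _ _ _ ha' => exact absurd (hc.trans ha) ha'
    | bot h2 ha' hs =>
      have ht := hΦ.eq_of_eq_bot h2.rotate' ha'
      exact absurd ha (hΦ.ne_of_opposite h1 h2 hq (hr ▸ hq) hs (ht ▸ hs))

end OrientedAt

/-- An orientation of `Φ`: a map `f` that commutes with complements, represents `Φ`, and takes the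
values that are determined by the lines. -/
structure IsOrientation (Φ : A → Set B) (f : A → B) : Prop where
  compl : ∀ a, f aᶜ = (f a)ᶜ
  eq_pt : ∀ a, Φ a = pt (f a)
  eq_of_orientedAt : ∀ {a y}, OrientedAt Φ a y → f a = y

/-- Where the rules decide at a or at aᶜ, they are followed. Otherwise `ρ` selects one element of
the pair, the value there is arbitrary, and the other element gets its complement; this needs a ≠
aᶜ. -/
theorem IsUnoriented.exists_isOrientation (hΦ : IsUnoriented Φ) (hA : (⊥ : A) ≠ ⊤) :
    ∃ f, IsOrientation Φ f := by
  classical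
  choose g hg using hΦ.exists_pt
  let ρ : Set A → A := fun S => Classical.epsilon fun b => pt b = S
  have hρ : ∀ a, a = ρ (pt a) ∨ aᶜ = ρ (pt a) := by
    intro a
    have h : pt (ρ (pt a)) = pt a := Classical.epsilon_spec (p := fun b => pt b = pt a) ⟨a, rfl⟩
    rcases pt_eq_iff.1 h with h | h
    · exact Or.inl h.symm
    · exact Or.inr h.symm
  let f : A → B := fun a =>
    if h : ∃ y, OrientedAt Φ a y then h.choose
    else if h : ∃ y, OrientedAt Φ aᶜ y then h.chooseᶜ
    else if a = ρ (pt a) then g a else (g aᶜ)ᶜ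
  have h1 : ∀ {a y}, OrientedAt Φ a y → f a = y := by
    intro a y h
    have h' : ∃ y, OrientedAt Φ a y := ⟨y, h⟩
    have : f a = h'.choose := dif_pos h'
    rw [this]
    exact h'.choose_spec.unique hΦ h
  have h2 : ∀ {a y}, OrientedAt Φ aᶜ y → f a = yᶜ := by
    intro a y h
    by_cases h' : ∃ y, OrientedAt Φ a y
    · obtain ⟨z, hz⟩ := h'
      rw [h1 hz, hz.compl_unique hΦ h, compl_compl']
    · have h'' : ∃ y, OrientedAt Φ aᶜ y := ⟨y, h⟩
      have : f a = h''.chooseᶜ := (dif_neg h').trans (dif_pos h'')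
      rw [this, h''.choose_spec.unique hΦ h]
  have h3 : ∀ {a}, (¬ ∃ y, OrientedAt Φ a y) → (¬ ∃ y, OrientedAt Φ aᶜ y) →
      f a = if a = ρ (pt a) then g a else (g aᶜ)ᶜ := fun h h' => (dif_neg h).trans (dif_neg h')
  refine ⟨f, fun a => ?_, fun a => ?_, h1⟩
  · by_cases ha : ∃ y, OrientedAt Φ a y
    · obtain ⟨y, hy⟩ := ha
      rw [h1 hy, h2 (a := aᶜ) (by rwa [compl_compl'])]
    by_cases ha' : ∃ y, OrientedAt Φ aᶜ y
    · obtain ⟨y, hy⟩ := ha'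
      rw [h1 hy, h2 hy, compl_compl']
    rw [h3 ha ha', h3 ha' (by rwa [compl_compl']), pt_compl, compl_compl']
    have hne := ne_compl_self (a := a) hA
    rcases hρ a with h | h
    · rw [if_pos h, if_neg (by rw [← h]; exact hne.symm)]
    · rw [if_pos h, if_neg (by rw [← h]; exact hne), compl_compl']
  · by_cases ha : ∃ y, OrientedAt Φ a y
    · obtain ⟨y, hy⟩ := ha
      rw [h1 hy, hy.eq_pt]
    by_cases ha' : ∃ y, OrientedAt Φ aᶜ y
    · obtain ⟨y, hy⟩ := ha'
      rw [h2 hy, pt_compl, ← hy.eq_pt, hΦ.compl]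
    rw [h3 ha ha']
    split_ifs
    · exact hg a
    · rw [pt_compl, ← hg, hΦ.compl]

namespace IsOrientation

theorem map_bot (hf : IsOrientation Φ f) (h : Φ q ≠ pt ⊥) (hΦ : IsUnoriented Φ) : f ⊥ = ⊥ :=
  hf.eq_of_orientedAt (.bot (isTriad_bot q) hΦ.bot h)

/-- A triad without null members orients its own three members, so only triads with a null member
remain, as `h0`. -/
theorem map_isTriad (hΦ : IsUnoriented Φ) (hf : IsOrientation Φ f)
    (h0 : ∀ {a b c}, IsTriad a b c → Φ a = pt ⊥ → IsTriad (f a) (f b) (f c)) (h : IsTriad a b c) :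
    IsTriad (f a) (f b) (f c) := by
  by_cases ha : Φ a = pt ⊥
  · exact h0 h ha
  by_cases hb : Φ b = pt ⊥
  · exact (h0 h.rotate hb).rotate'
  by_cases hc : Φ c = pt ⊥
  · exact (h0 h.rotate' hc).rotate
  obtain ⟨x, y, z, h', hx, hy, hz⟩ := hΦ.triad h ha hb hc
  rw [hf.eq_of_orientedAt (.triad h ha hb hc h' hx hy hz),
    hf.eq_of_orientedAt (.triad h.rotate hb hc ha h'.rotate hy hz hx),
    hf.eq_of_orientedAt (.triad h.rotate' hc ha hb h'.rotate' hz hx hy)]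
  exact h'

/-- If `b` and `e` are complementary modulo a null element and `b` splits, then the orientations of
`b` and `e` are opposite. -/
theorem eq_compl_of_split (hΦ : IsUnoriented Φ) (hf : IsOrientation Φ f) (h : IsTriad a b e)
    (ha : Φ a = pt ⊥) (hb : Φ b ≠ pt ⊥) (h' : IsTriad x y bᶜ) (hx : Φ x ≠ pt ⊥)
    (hy : Φ y ≠ pt ⊥) : f b = (f e)ᶜ := by
  have he : Φ b = Φ e := hΦ.eq_of_eq_bot h ha
  -- Here v = y ⊕ a differs from y by a null element. So the triads x, y, bᶜ and x, v, e have the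
  -- same image line, and bᶜ and e get the same value.
  obtain ⟨v, w, ht⟩ := h'.exists_isTetrad (c := e) (d := a) (by simpa using h.rotate')
  have hv : Φ y = Φ v := hΦ.eq_of_eq_bot' ht.bd.swap ha
  have hbc : Φ bᶜ ≠ pt ⊥ := by rwa [hΦ.compl]
  obtain ⟨x₁, y₁, z₁, t₁, hx₁, hy₁, hz₁⟩ := hΦ.triad h' hx hy hbc
  have hxve := ht.ac.rotate'.swap
  obtain ⟨x₂, y₂, z₂, t₂, hx₂, hy₂, hz₂⟩ := hΦ.triad hxve hx (hv ▸ hy) (he ▸ hb)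
  have e1 := t₁.eq_of_pt_eq t₂ (ne_bot_of_pt (hx₁ ▸ hx)) (ne_bot_of_pt (hy₁ ▸ hy))
    (ne_bot_of_pt (hz₁ ▸ hbc)) (hx₁.symm.trans hx₂) (hy₁.symm.trans (hv.trans hy₂))
  have f1 : f bᶜ = z₁ := hf.eq_of_orientedAt (.triad h' hx hy hbc t₁ hx₁ hy₁ hz₁)
  have f2 : f e = z₂ := hf.eq_of_orientedAt (.triad hxve hx (hv ▸ hy) (he ▸ hb) t₂ hx₂ hy₂ hz₂)
  rw [f2, ← e1.2.2, ← f1, hf.compl, compl_compl']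

/-- The non-null x lies below a, hence is orthogonal to aᶜ, b and e. Being null, these three go to
0, and a goes to 1. -/
theorem map_isTriad_of_split (hΦ : IsUnoriented Φ) (hf : IsOrientation Φ f) (h : IsTriad a b e)
    (ha : Φ a = pt ⊥) (hb : Φ b = pt ⊥) (he : Φ e = pt ⊥) (h' : IsTriad x y aᶜ)
    (hx : Φ x ≠ pt ⊥) : IsTriad (f a) (f b) (f e) := by
  have h1 : f aᶜ = ⊥ := hf.eq_of_orientedAt (.bot h' ((hΦ.compl a).trans ha) hx)
  obtain ⟨v, w, ht⟩ := h'.exists_isTetrad (c := b) (d := e) (by simpa using h.rotate)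
  have h2 : f b = ⊥ := hf.eq_of_orientedAt (.bot ht.ac.rotate'.swap hb hx)
  have h3 : f e = ⊥ := hf.eq_of_orientedAt (.bot ht.ad.rotate'.swap he hx)
  have h4 : f a = ⊤ := by
    rw [← compl_eq_bot', ← hf.compl, h1]
  rw [h2, h3, h4]
  exact isTriad_bot_iff.2 compl_top'.symm

end IsOrientation

theorem IsBooleanChart.mono {X : Type u} [BooleanAlgebra X] {i : X → A} (h : IsBooleanChart i)
    {x y : X} (hxy : x ≤ y) : i x ≤ i y := by
  have := (isOrthosum_iff.1 (h.isOrthosum x (y \ x) disjoint_sdiff_self_right)).2.1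
  rwa [sup_sdiff_cancel_right hxy] at this

theorem IsBooleanChart.disjoint {X : Type u} [BooleanAlgebra X] {i : X → A} (h : IsBooleanChart i)
    (hi : Function.Injective i) (h0 : i ⊥ = ⊥) {x y : X} (hxy : i x ≤ (i y)ᶜ) : Disjoint x y := by
  rw [disjoint_iff]
  apply hi
  rw [h0]
  exact eq_bot_of_le_of_le_compl (h.mono inf_le_right) ((h.mono inf_le_left).trans hxy)

theorem _root_.IsBooleanSubalgebra.exists_chart_triad {C : Set A} (hC : IsBooleanSubalgebra C)
    (h : IsTriad a b e) (ha : a ∈ C) (hb : b ∈ C) (he : e ∈ C) :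
    ∃ (X : Type u) (_ : BooleanAlgebra X) (i : X → A), IsBooleanChart i ∧ Set.range i = C ∧
      ∃ x y z : X, i x = a ∧ i y = b ∧ i z = e ∧ Disjoint x y ∧ Disjoint x z ∧ Disjoint y z ∧
        x ⊔ (y ⊔ z) = ⊤ := by
  obtain ⟨X, _, i, hi, hinj, rfl, h0⟩ := hC.exists_chart
  obtain ⟨x, rfl⟩ := ha
  obtain ⟨y, rfl⟩ := hb
  obtain ⟨z, rfl⟩ := he
  have hxy := hi.disjoint hinj h0 h.1
  have hz : z = (x ⊔ y)ᶜ := hinj (h.unique (hi.isTriad hxy rfl))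
  refine ⟨X, _, i, hi, rfl, x, y, z, rfl, rfl, rfl, hxy, hi.disjoint hinj h0 h.le₁₃,
    hi.disjoint hinj h0 h.le₂₃, ?_⟩
  rw [← sup_assoc, hz, sup_compl_eq_top]

theorem IsUnoriented.sup_of_eq_bot (hΦ : IsUnoriented Φ) {X : Type u} [BooleanAlgebra X] {i : X → A}
    (hi : IsBooleanChart i) {x y : X} (hxy : Disjoint x y) (hx : Φ (i x) = pt ⊥) :
    Φ (i (x ⊔ y)) = Φ (i y) := by
  have := hΦ.eq_of_eq_bot (hi.isTriad hxy rfl) hx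
  rw [this, hi.map_compl, hΦ.compl]

theorem IsUnoriented.inf_compl_of_eq_bot (hΦ : IsUnoriented Φ) {X : Type u} [BooleanAlgebra X]
    {i : X → A} (hi : IsBooleanChart i) {x t : X} (hx : Φ (i (x ⊓ t)) = pt ⊥) :
    Φ (i (x ⊓ tᶜ)) = Φ (i x) := by
  rw [← hΦ.sup_of_eq_bot hi (disjoint_compl_right.mono inf_le_right inf_le_right) hx, ← inf_sup_left,
    sup_compl_eq_top, inf_top_eq]

/-- Null disjoint parts of t can be dropped without changing the value. -/
theorem IsUnoriented.eq_inf (hΦ : IsUnoriented Φ) {X : Type u} [BooleanAlgebra X]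
    {i : X → A} (hi : IsBooleanChart i) {x y z t : X} (hxy : Disjoint x y) (hxz : Disjoint x z)
    (hyz : Disjoint y z) (h : x ⊔ (y ⊔ z) = ⊤) (hx : Φ (i (x ⊓ t)) = pt ⊥)
    (hy : Φ (i (y ⊓ t)) = pt ⊥) : Φ (i t) = Φ (i (z ⊓ t)) := by
  have e1 := hΦ.sup_of_eq_bot hi (y := z ⊓ t) (hyz.mono inf_le_left inf_le_left) hy
  have e2 := hΦ.sup_of_eq_bot hi (x := x ⊓ t) (y := (y ⊔ z) ⊓ t)
    ((hxy.sup_right hxz).mono inf_le_left inf_le_left) hx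
  rw [← inf_sup_right] at e1
  rw [← inf_sup_right, h, top_inf_eq] at e2
  exact e2.trans e1

/-! ### Properness on the level of elements, and its consequences. -/

/-- Every triad lies in a Boolean subalgebra on which `Φ` takes two nontrivial values. -/
def IsElemProper (Φ : A → Set B) : Prop :=
  ∀ a b e, IsTriad a b e → ∃ C : Set A, IsBooleanSubalgebra C ∧ a ∈ C ∧ b ∈ C ∧ e ∈ C ∧
    ∃ s ∈ C, ∃ t ∈ C, Φ s ≠ pt ⊥ ∧ Φ t ≠ pt ⊥ ∧ Φ s ≠ Φ t

namespace IsElemProper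

theorem exists_ne (h : IsElemProper Φ) : ∃ a, Φ a ≠ pt ⊥ := by
  obtain ⟨C, -, -, -, -, s, -, t, -, hs, -⟩ := h _ _ _ (isTriad_bot ⊥)
  exact ⟨s, hs⟩

/-- Properness gives a non-null t with a value other than that of b. All parts of a are null, so t
has the value of its parts in b and e. If neither b nor e had two complementary non-null parts, t or
its complement would reduce to nothing or to one whole of b and e, which share a value. -/
theorem exists_split_of_ne (hp : IsElemProper Φ) (hΦ : IsUnoriented Φ) (h : IsTriad a b e)
    (ha : Φ a = pt ⊥) (hb : Φ b ≠ pt ⊥) :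
    (∃ x y, IsTriad x y bᶜ ∧ Φ x ≠ pt ⊥ ∧ Φ y ≠ pt ⊥) ∨
      ∃ x y, IsTriad x y eᶜ ∧ Φ x ≠ pt ⊥ ∧ Φ y ≠ pt ⊥ := by
  obtain ⟨C, hC, haC, hbC, heC, hst⟩ := hp a b e h
  have ht : ∃ t ∈ C, Φ t ≠ pt ⊥ ∧ Φ t ≠ Φ b := by
    obtain ⟨s, hsC, t, htC, hs, ht, hst⟩ := hst
    by_cases hsb : Φ s = Φ b
    · exact ⟨t, htC, ht, fun h => hst (hsb.trans h.symm)⟩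
    · exact ⟨s, hsC, hs, hsb⟩
  obtain ⟨t, htC, ht0, htb⟩ := ht
  obtain ⟨X, _, i, hi, rfl, x, y, z, rfl, rfl, rfl, hxy, hxz, hyz, htop⟩ :=
    hC.exists_chart_triad h haC hbC heC
  obtain ⟨t, rfl⟩ := htC
  have hsplit : ∀ x t : X, IsTriad (i (x ⊓ t)) (i (x ⊓ tᶜ)) (i x)ᶜ := fun x t => by
    rw [← hi.map_compl]
    refine hi.isTriad (disjoint_compl_right.mono inf_le_right inf_le_right) ?_
    rw [← inf_sup_left, sup_compl_eq_top, inf_top_eq]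
  have hyz' : Φ (i y) = Φ (i z) := hΦ.eq_of_eq_bot h ha
  have hxt : ∀ t, Φ (i (x ⊓ t)) = pt ⊥ := fun t =>
    hΦ.eq_bot_of_split h.rotate (hsplit x t) ha hb
  by_contra! hcon
  obtain ⟨h1, h2⟩ := hcon
  have hy := h1 _ _ (hsplit y t)
  have hz := h2 _ _ (hsplit z t)
  by_cases hy1 : Φ (i (y ⊓ t)) = pt ⊥
  · have e1 := hΦ.eq_inf hi hxy hxz hyz htop (hxt t) hy1
    by_cases hz1 : Φ (i (z ⊓ t)) = pt ⊥
    · exact ht0 (e1.trans hz1)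
    · have e2 := hΦ.inf_compl_of_eq_bot hi (hz hz1)
      rw [compl_compl] at e2
      exact htb (e1.trans (e2.trans hyz'.symm))
  · have hy2 := hy hy1
    have e2 := hΦ.inf_compl_of_eq_bot hi hy2
    rw [compl_compl] at e2
    by_cases hz1 : Φ (i (z ⊓ t)) = pt ⊥
    · have e1 := hΦ.eq_inf hi hxz hxy hyz.symm (by rwa [sup_comm z]) (hxt t) hz1
      exact htb (e1.trans e2)
    · have e1 := hΦ.eq_inf hi hxy hxz hyz htop (hxt tᶜ) hy2
      rw [hz hz1, hi.map_compl, hΦ.compl] at e1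
      exact ht0 e1

/-- Otherwise all three parts of every t in the Boolean subalgebra are null, and so is t. -/
theorem exists_split_of_eq (hp : IsElemProper Φ) (hΦ : IsUnoriented Φ) (h : IsTriad a b e) :
    (∃ x y, IsTriad x y aᶜ ∧ Φ x ≠ pt ⊥) ∨ (∃ x y, IsTriad x y bᶜ ∧ Φ x ≠ pt ⊥) ∨
      ∃ x y, IsTriad x y eᶜ ∧ Φ x ≠ pt ⊥ := by
  obtain ⟨C, hC, haC, hbC, heC, t, htC, -, -, ht0, -⟩ := hp a b e h
  obtain ⟨X, _, i, hi, rfl, x, y, z, rfl, rfl, rfl, hxy, hxz, hyz, htop⟩ :=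
    hC.exists_chart_triad h haC hbC heC
  obtain ⟨t, rfl⟩ := htC
  have hsplit : ∀ x t : X, IsTriad (i (x ⊓ t)) (i (x ⊓ tᶜ)) (i x)ᶜ := fun x t => by
    rw [← hi.map_compl]
    refine hi.isTriad (disjoint_compl_right.mono inf_le_right inf_le_right) ?_
    rw [← inf_sup_left, sup_compl_eq_top, inf_top_eq]
  by_contra! hcon
  obtain ⟨h1, h2, h3⟩ := hcon
  exact ht0 ((hΦ.eq_inf hi hxy hxz hyz htop (h1 _ _ (hsplit x t)) (h2 _ _ (hsplit y t))).trans
    (h3 _ _ (hsplit z t)))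

theorem map_isTriad (hp : IsElemProper Φ) (hΦ : IsUnoriented Φ) (hf : IsOrientation Φ f)
    (h : IsTriad a b c) : IsTriad (f a) (f b) (f c) := by
  refine hf.map_isTriad hΦ (fun {a b e} h ha => ?_) h
  by_cases hb : Φ b = pt ⊥
  · have he : Φ e = pt ⊥ := (hΦ.eq_of_eq_bot h ha).symm.trans hb
    rcases hp.exists_split_of_eq hΦ h with ⟨x, y, h', hx⟩ | ⟨x, y, h', hx⟩ | ⟨x, y, h', hx⟩
    · exact hf.map_isTriad_of_split hΦ h ha hb he h' hx
    · exact (hf.map_isTriad_of_split hΦ h.rotate hb he ha h' hx).rotate'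
    · exact (hf.map_isTriad_of_split hΦ h.rotate' he ha hb h' hx).rotate
  -- The null a goes to 0, so it remains to see that b and e get complementary values; a split of
  -- either one gives this.
  · have he : Φ b = Φ e := hΦ.eq_of_eq_bot h ha
    have h0 : f a = ⊥ := hf.eq_of_orientedAt (.bot h.rotate ha hb)
    rw [h0, isTriad_bot_iff']
    rcases hp.exists_split_of_ne hΦ h ha hb with ⟨x, y, h', hx, hy⟩ | ⟨x, y, h', hx, hy⟩
    · rw [hf.eq_compl_of_split hΦ h ha hb h' hx hy, compl_compl']
    · exact hf.eq_compl_of_split hΦ h.rotate'.swap ha (he ▸ hb) h' hx hy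

/-- Apply properness to the degenerate triad 0, a, a': a split of a orients a', and a split of a'
orients a. -/
theorem exists_orientedAt (hp : IsElemProper Φ) (hΦ : IsUnoriented Φ) (a : A) :
    (∃ y, OrientedAt Φ a y) ∨ ∃ y, OrientedAt Φ aᶜ y := by
  have h : IsTriad ⊥ a aᶜ := isTriad_bot_iff'.2 rfl
  by_cases ha : Φ a = pt ⊥
  · have hac : Φ aᶜ = pt ⊥ := (hΦ.compl a).trans ha
    rcases hp.exists_split_of_eq hΦ h with ⟨x, y, h', hx⟩ | ⟨x, y, h', hx⟩ | ⟨x, y, h', hx⟩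
    · refine absurd ?_ hx
      have : x = ⊥ := by
        rw [← le_bot_iff]
        simpa using h'.le₁₃
      rw [this, hΦ.bot]
    · exact Or.inr ⟨_, .bot h' hac hx⟩
    · exact Or.inl ⟨_, .bot (by simpa using h') ha hx⟩
  · have key : ∀ {a x y}, Φ a ≠ pt ⊥ → IsTriad x y a → Φ x ≠ pt ⊥ → Φ y ≠ pt ⊥ →
        ∃ z, OrientedAt Φ a z := by
      intro a x y ha h hx hy
      obtain ⟨x', y', z, h', hx', hy', hz⟩ := hΦ.triad h hx hy ha
      exact ⟨z, .triad h hx hy ha h' hx' hy' hz⟩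
    rcases hp.exists_split_of_ne hΦ h hΦ.bot ha with ⟨x, y, h', hx, hy⟩ | ⟨x, y, h', hx, hy⟩
    · exact Or.inr (key (by rwa [hΦ.compl]) h' hx hy)
    · exact Or.inl (key ha (by simpa using h') hx hy)

end IsElemProper

end OrthomodularPoset

/-! ### Unique lifting of proper unoriented maps. -/

namespace OMP.Hom

open OrthomodularPoset

variable {A B : OMP.{u}}

theorem eq_of_orientedAt {Φ : A → Set B} (f : OMP.Hom A B) (hf : ∀ a, Φ a = pt (f.toFun a)) {a : A}
    {y : B} (h : OrientedAt Φ a y) : f.toFun a = y := by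
  cases h with
  | triad h hq hr ha h' eq er ea =>
    exact ((f.map_isTriad h).eq_of_pt_eq h' (ne_bot_of_pt (hf _ ▸ hq)) (ne_bot_of_pt (hf _ ▸ hr))
      (ne_bot_of_pt (hf _ ▸ ha)) ((hf _).symm.trans eq) ((hf _).symm.trans er)).2.2
  | bot h ha hq =>
    rw [hf] at ha hq
    rcases pt_eq_bot_iff.1 ha with h0 | h0
    · exact h0
    · exact absurd ((f.map_isTriad h).rotate'.eq_bot_of_eq_top h0).1 (ne_bot_of_pt hq)

theorem eq_of_isElemProper {Φ : A → Set B} (hp : IsElemProper Φ) (hΦ : IsUnoriented Φ)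
    {f g : OMP.Hom A B} (hf : ∀ a, Φ a = pt (f.toFun a)) (hg : ∀ a, Φ a = pt (g.toFun a)) :
    f = g := by
  refine OMP.Hom.ext (funext fun a => ?_)
  rcases hp.exists_orientedAt hΦ a with ⟨y, hy⟩ | ⟨y, hy⟩
  · rw [f.eq_of_orientedAt hf hy, g.eq_of_orientedAt hg hy]
  · have := (f.eq_of_orientedAt hf hy).trans (g.eq_of_orientedAt hg hy).symm
    rw [f.map_compl, g.map_compl] at this
    exact compl_injective' this

theorem exists_of_isElemProper {Φ : A → Set B} (hp : IsElemProper Φ) (hΦ : IsUnoriented Φ) :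
    ∃ f : OMP.Hom A B, ∀ a, Φ a = pt (f.toFun a) := by
  obtain ⟨q, hq⟩ := hp.exists_ne
  have hA : (⊥ : A) ≠ ⊤ := by
    intro h
    apply hq
    have : q = ⊥ := by rw [← le_bot_iff, h]; exact le_top
    rw [this, hΦ.bot]
  obtain ⟨f, hf⟩ := hΦ.exists_isOrientation hA
  exact ⟨ofIsTriad f (hf.map_bot hq hΦ) hf.compl fun a b c h => hp.map_isTriad hΦ hf h, hf.eq_pt⟩

end OMP.Hom

/-! ### Boolean sets versus Boolean subalgebras, and the two notions of properness. -/

namespace OrthomodularPoset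

section Proper

variable {A B : OMP.{u}} {a b c e p q : A} {C : Set A}

theorem tri_encard_le : (tri a b c).encard ≤ 8 := by
  have key : ∀ (x : A) {s : Set A} {n : ℕ∞}, s.encard ≤ n → (insert x s).encard ≤ n + 1 :=
    fun x s n h => (Set.encard_insert_le s x).trans (by gcongr)
  have := key ⊥ (key ⊤ (key a (key aᶜ (key b (key bᶜ (key c (Set.encard_singleton cᶜ).le))))))
  exact this.trans (by norm_num)

/-- If all nontrivial values formed a single complementary pair, the image would lie in one `pt b`.
-/
theorem _root_.OMP.Hom.exists_of_four_lt {f : OMP.Hom A B}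
    (h : 4 < (f.toFun '' C).encard) :
    ∃ s ∈ C, ∃ t ∈ C, pt (f.toFun s) ≠ pt ⊥ ∧ pt (f.toFun t) ≠ pt ⊥ ∧
      pt (f.toFun s) ≠ pt (f.toFun t) := by
  by_contra! hcon
  have key : ∀ b : B, (∀ t ∈ C, f.toFun t ∈ pt b) → False := by
    intro b hb
    have h1 := Set.encard_le_encard (Set.image_subset_iff.2 hb)
    exact absurd (h.trans_le (h1.trans pt_encard_le)) (lt_irrefl _)
  by_cases hs : ∃ s ∈ C, pt (f.toFun s) ≠ pt ⊥
  · obtain ⟨s, hsC, hs⟩ := hs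
    refine key (f.toFun s) fun t ht => ?_
    by_cases ht0 : pt (f.toFun t) = pt ⊥
    · rcases pt_eq_bot_iff.1 ht0 with h | h <;> rw [h] <;> simp [pt]
    · rw [hcon s hsC t ht hs ht0]
      exact self_mem_pt
  · push Not at hs
    exact key ⊥ fun t ht => hs t ht ▸ self_mem_pt

theorem _root_.IsBooleanSubalgebra.four_lt (hC : IsBooleanSubalgebra C) {f : OMP.Hom A B} {s t : A}
    (hs : s ∈ C) (ht : t ∈ C) (hs0 : pt (f.toFun s) ≠ pt ⊥) (ht0 : pt (f.toFun t) ≠ pt ⊥)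
    (hst : pt (f.toFun s) ≠ pt (f.toFun t)) : 4 < (f.toFun '' C).encard := by
  by_contra! h
  have key : ∀ x ∈ C, pt (f.toFun x) ≠ pt ⊥ → pt (f.toFun x) = f.toFun '' C := by
    intro x hx hx0
    have hsub : pt (f.toFun x) ⊆ f.toFun '' C := by
      rw [← f.image_pt]
      exact Set.image_mono (hC.pt_subset hx)
    refine Set.Finite.eq_of_subset_of_encard_le ?_ hsub ?_
    · exact (Set.finite_of_encard_le_coe (k := 4) h).subset hsub
    · rw [pt_encard hx0]
      exact h
  exact hst ((key s hs hs0).trans (key t ht ht0).symm)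

theorem isProper_iff_isElemProper (f : A ⟶ B) :
    OMP.IsProper f ↔ IsElemProper fun a => pt (OMP.Hom.toFun f a) := by
  constructor
  · intro h a b e habe
    obtain ⟨C, hC, hsub, h4⟩ := h _ habe.isBooleanSubalgebra_tri tri_encard_le
    exact ⟨C, hC, hsub (by simp [tri]), hsub (by simp [tri]), hsub (by simp [tri]),
      OMP.Hom.exists_of_four_lt h4⟩
  · intro h C hC h8
    obtain ⟨a, b, e, habe, rfl⟩ := hC.exists_triad h8
    obtain ⟨D, hD, ha, hb, he, s, hs, t, ht, hs0, ht0, hst⟩ := h a b e habe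
    exact ⟨D, hD, hD.tri_subset ha hb he, hD.four_lt hs ht hs0 ht0 hst⟩

theorem _root_.IsBooleanSubalgebra.splitIn (hC : IsBooleanSubalgebra C) (hp : p ∈ C) (hq : q ∈ C) :
    SplitIn C p q := by
  obtain ⟨X, _, i, hi, -, rfl, -⟩ := hC.exists_chart
  obtain ⟨x, rfl⟩ := hp
  obtain ⟨y, rfl⟩ := hq
  have key : ∀ x y z t : X, Disjoint x y → x ⊔ y = z → t = zᶜ → IsTriad (i x) (i y) (i t) :=
    fun x y z t h h' h'' => hi.isTriad h (by rw [h', h''])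
  refine ⟨_, ⟨x ⊓ yᶜ, rfl⟩, _, ⟨y ⊓ xᶜ, rfl⟩, _, ⟨x ⊓ y, rfl⟩, _, ⟨(x ⊔ y)ᶜ, rfl⟩, ?_⟩
  rw [← hi.map_compl, ← hi.map_compl]
  refine ⟨key _ _ x _ ?_ ?_ rfl, key _ _ xᶜ _ ?_ ?_ (compl_compl x).symm, key _ _ y _ ?_ ?_ rfl,
    key _ _ yᶜ _ ?_ ?_ (compl_compl y).symm⟩
  · exact disjoint_compl_left.mono inf_le_right inf_le_right
  · rw [← inf_sup_left, sup_comm, sup_compl_eq_top, inf_top_eq]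
  · rw [compl_sup]
    exact disjoint_compl_right.mono inf_le_left inf_le_right
  · rw [compl_sup, inf_comm, ← inf_sup_left, sup_compl_eq_top, inf_top_eq]
  · exact disjoint_compl_left.mono inf_le_right inf_le_left
  · rw [inf_comm x y, ← inf_sup_left, sup_comm, sup_compl_eq_top, inf_top_eq]
  · rw [compl_sup]
    exact disjoint_compl_right.mono inf_le_left inf_le_left
  · rw [compl_sup, ← inf_sup_right, sup_compl_eq_top, top_inf_eq]

/-- Two elements of C cut 1 into four cells in C. If a cell is 0, the two points lie on a line;
otherwise they are midpoints of the plane of the four cells. -/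
theorem _root_.IsBooleanSubalgebra.isBooleanSet (hC : IsBooleanSubalgebra C) :
    (orthogeometry A).IsBooleanSet {P : FourElementSubalgebra A | P.1 ⊆ C} := by
  intro P hP Q hQ hPQ
  obtain ⟨p, hp0, hp⟩ := FourElementSubalgebra.exists_pt P
  obtain ⟨q, hq0, hq⟩ := FourElementSubalgebra.exists_pt Q
  have hpC : p ∈ C := hP (hp ▸ self_mem_pt)
  have hqC : q ∈ C := hQ (hq ▸ self_mem_pt)
  have hpq : pt p ≠ pt q := fun h =>
    hPQ (FourElementSubalgebra.ext_iff.2 (hp.trans (h.trans hq.symm)))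
  have line : ∀ {x y z : A}, IsTriad x y z → x ∈ C → y ∈ C → z ∈ C → P.1 = pt x → Q.1 = pt y →
      ∃ t ∈ (orthogeometry A).lines ∪ (orthogeometry A).planes,
        P ∈ t ∧ Q ∈ t ∧ t ⊆ {P : FourElementSubalgebra A | P.1 ⊆ C} := by
    intro x y z h hx hy hz hPx hQy
    have hz0 : z ≠ ⊥ := by
      rintro rfl
      rw [isTriad_bot_iff.1 h, pt_compl] at hQy
      exact hPQ (FourElementSubalgebra.ext_iff.2 (hPx.trans hQy.symm))
    have hR : (mkPt z (h.rotate'.pt_ne_pt_bot hz0 (FourElementSubalgebra.ne_bot hPx))).1 = pt z :=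
      rfl
    refine ⟨_, .inl (h.mem_subalgebraLines hPx hQy hR), by simp, by simp, ?_⟩
    rintro R (rfl | rfl | rfl)
    exacts [hP, hQ, hC.pt_subset hz]
  obtain ⟨x, hx, y, hy, z, hz, w, hw, h1, h2, h3, h4⟩ := hC.splitIn hpC hqC
  have hqc := hC.compl_mem _ hqC
  have hpc := hC.compl_mem _ hpC
  have hp' : P.1 = pt pᶜ := by rwa [pt_compl]
  have hq' : Q.1 = pt qᶜ := by rwa [pt_compl]
  by_cases hx0 : x = ⊥
  · subst hx0
    have e := isTriad_bot_iff'.1 h1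
    obtain rfl := compl_injective' e
    exact line h3.rotate hpC hqc hy hp hq'
  by_cases hy0 : y = ⊥
  · subst hy0
    have e := isTriad_bot_iff'.1 h3
    obtain rfl := compl_injective' e
    exact line h1.swap.rotate' hpc hqC hx hp' hq
  by_cases hz0 : z = ⊥
  · subst hz0
    have e := isTriad_bot_iff''.1 h3
    obtain rfl := compl_injective' e
    exact line h2.rotate' hpC hqC hw hp hq
  by_cases hw0 : w = ⊥
  · subst hw0
    have e := isTriad_bot_iff''.1 h4
    subst e
    exact line h1.rotate' hpc hx hz hp' (by rwa [pt_compl] at hq)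
  obtain ⟨v, r, ht⟩ := h1.exists_isTetrad (c := y) (d := w) (by simpa using h2)
  obtain rfl : q = r := h4.unique ht.ad
  have hvC : v ∈ C := by
    have := hC.compl_mem _ (hC.orthosum_mem _ hx _ hy _ ht.ac)
    simpa using this
  have hV : (mkPt v (ht.ac.pt_middle_ne ht.bd hx0 hz0)).1 = pt v := rfl
  have hX : (mkPt x (h1.pt_ne_pt_bot hx0 hz0)).1 = pt x := rfl
  have hZ : (mkPt z (h1.swap.pt_ne_pt_bot hz0 hx0)).1 = pt z := rfl
  have hY : (mkPt y (h2.pt_ne_pt_bot hy0 hw0)).1 = pt y := rfl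
  have hW : (mkPt w (h2.swap.pt_ne_pt_bot hw0 hy0)).1 = pt w := rfl
  refine ⟨_, .inr ⟨_, _, _, _, _, _, _, ht.isPlane hX hZ hY hW hp' hV hq, rfl⟩, by simp, by simp, ?_⟩
  rintro R (rfl | rfl | rfl | rfl | rfl | rfl | rfl)
  exacts [hC.pt_subset hx, hC.pt_subset hz, hC.pt_subset hy, hC.pt_subset hw, hP,
    hC.pt_subset hvC, hQ]

/-- The union of a set of points, together with `⊥` and `⊤`. -/
def pointsUnion (S : Set (FourElementSubalgebra A)) : Set A := pt ⊥ ∪ {x | ∃ P ∈ S, x ∈ P.1}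

theorem _root_.FourElementSubalgebra.pt_eq {P : FourElementSubalgebra A} (h : a ∈ P.1) :
    pt a = pt ⊥ ∨ P.1 = pt a := by
  obtain ⟨x, -, hP⟩ := P.exists_pt
  rw [hP] at h ⊢
  rcases h with rfl | rfl | rfl | rfl
  · exact .inl rfl
  · exact .inl pt_top
  · exact .inr rfl
  · exact .inr pt_compl.symm

/-- By the refinement criterion only pairs matter. A line or plane in S joining two points supplies
a triad or tetrad, whose members form the refinement. -/
theorem isBooleanSubalgebra_pointsUnion {S : Set (FourElementSubalgebra A)}
    (hS : (orthogeometry A).IsBooleanSet S) : IsBooleanSubalgebra (pointsUnion S) := by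
  have h0 : ⊥ ∈ pointsUnion S := .inl self_mem_pt
  have hmem : ∀ {x : A} {P}, P ∈ S → P.1 = pt x → x ∈ pointsUnion S := fun {x P} hP h =>
    .inr ⟨P, hP, h ▸ self_mem_pt⟩
  have hcl : ∀ a ∈ pointsUnion S, aᶜ ∈ pointsUnion S := by
    rintro a (ha | ⟨P, hP, ha⟩)
    · exact .inl ((isBooleanSubalgebra_pt ⊥).compl_mem a ha)
    · exact .inr ⟨P, hP, P.2.1.compl_mem a ha⟩
  have hbot : ∀ {a b : A}, a ∈ pointsUnion S → pt b = pt ⊥ → SplitIn (pointsUnion S) b a :=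
    fun {a b} ha hb => (SplitIn.of_isTriad (isTriad_bot_iff'.2 rfl) h0 h0 ha (hcl _ ha)).of_pt_eq
      hb.symm rfl
  refine isBooleanSubalgebra_of_splitIn h0 hcl fun p hp q hq => ?_
  have aux : ∀ a ∈ pointsUnion S, pt a = pt ⊥ ∨ ∃ P ∈ S, P.1 = pt a := by
    rintro a (ha | ⟨P, hP, ha⟩)
    · exact .inl (pt_eq_bot_iff.2 (mem_pt_bot.1 ha))
    · exact (P.pt_eq ha).imp id fun h => ⟨P, hP, h⟩
  rcases aux p hp with h | ⟨P, hP, hPp⟩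
  · exact hbot hq h
  rcases aux q hq with h | ⟨Q, hQ, hQq⟩
  · exact (hbot hp h).symm
  by_cases hPQ : P = Q
  · subst hPQ
    exact (SplitIn.refl h0 hcl hp).of_pt_eq rfl (hPp.symm.trans hQq)
  obtain ⟨t, ht | ⟨P₁, P₂, P₃, P₄, U, V, W, hpl, rfl⟩, hPt, hQt, hts⟩ := hS P hP Q hQ hPQ
  · obtain ⟨a, b, c, habc, ha, hb, hc, hPa, hQb, rfl⟩ := exists_of_mem_subalgebraLines' ht hPQ hPt hQt
    have hcS : c ∈ pointsUnion S := by
      have : (mkPt c (habc.rotate'.pt_ne_pt_bot hc ha)).1 ⊆ tri a b c := by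
        rw [tri_eq_union]
        exact Set.subset_union_right
      exact hmem (hts this) rfl
    exact (SplitIn.of_isTriad habc h0 (hmem hP hPa) (hmem hQ hQb) hcS).of_pt_eq
      (hPa.symm.trans hPp) (hQb.symm.trans hQq)
  · obtain ⟨a, b, c, d, u, v, w, h, ha, hb, hc, hd, hu, hv, hw⟩ := exists_isTetrad_of_isPlane hpl
    have ma : a ∈ pointsUnion S := hmem (hts (by simp)) ha
    have mb : b ∈ pointsUnion S := hmem (hts (by simp)) hb
    have mc : c ∈ pointsUnion S := hmem (hts (by simp)) hc
    have md : d ∈ pointsUnion S := hmem (hts (by simp)) hd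
    have mu : u ∈ pointsUnion S := hmem (hts (by simp)) hu
    have mv : v ∈ pointsUnion S := hmem (hts (by simp)) hv
    have mw : w ∈ pointsUnion S := hmem (hts (by simp)) hw
    have line : ∀ {x y z : A}, IsTriad x y z → x ∈ pointsUnion S → y ∈ pointsUnion S →
        z ∈ pointsUnion S → SplitIn (pointsUnion S) x y ∧ SplitIn (pointsUnion S) x z ∧
          SplitIn (pointsUnion S) y z := fun h hx hy hz =>
      ⟨.of_isTriad h h0 hx hy hz, .of_isTriad h.rotate'.swap h0 hx hz hy,
        .of_isTriad h.rotate h0 hy hz hx⟩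
    obtain ⟨s1, s2, s3⟩ := line h.ab ma mb mu
    obtain ⟨s4, s5, s6⟩ := line h.cd mc md (hcl _ mu)
    obtain ⟨s7, s8, s9⟩ := line h.ac ma mc mv
    obtain ⟨s10, s11, s12⟩ := line h.bd mb md (hcl _ mv)
    obtain ⟨s13, s14, s15⟩ := line h.ad ma md mw
    obtain ⟨s16, s17, s18⟩ := line h.bc mb mc (hcl _ mw)
    rw [SplitIn.compl_right_iff] at s5 s6 s11 s12 s17 s18
    -- The remaining pairs are those of midpoints; relabelling the tetrad covers all three.
    have s19 := SplitIn.of_isTetrad h ma mc mb md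
    have s20 := SplitIn.of_isTetrad ⟨h.ab, h.cd.swap, h.ad, h.bc, h.ac, h.bd⟩ ma md mb mc
    have s21 := SplitIn.of_isTetrad ⟨h.ac, h.bd, h.ab, h.cd, h.ad, h.bc.swap⟩ ma mb mc md
    have key : ∀ x ∈ ({a, b, c, d, u, v, w} : Set A), ∀ y ∈ ({a, b, c, d, u, v, w} : Set A),
        SplitIn (pointsUnion S) x y := by
      have hr : ∀ {x}, x ∈ pointsUnion S → SplitIn (pointsUnion S) x x := SplitIn.refl h0 hcl
      rintro x (rfl | rfl | rfl | rfl | rfl | rfl | rfl) y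
        (rfl | rfl | rfl | rfl | rfl | rfl | rfl) <;>
        first
        | assumption
        | exact hr (by assumption)
        | exact SplitIn.symm (by assumption)
    have lift : ∀ R ∈ ({P₁, P₂, P₃, P₄, U, V, W} : Set (FourElementSubalgebra A)),
        ∃ x ∈ ({a, b, c, d, u, v, w} : Set A), R.1 = pt x := by
      rintro R (rfl | rfl | rfl | rfl | rfl | rfl | rfl)
      exacts [⟨a, by simp, ha⟩, ⟨b, by simp, hb⟩, ⟨c, by simp, hc⟩, ⟨d, by simp, hd⟩,
        ⟨u, by simp, hu⟩, ⟨v, by simp, hv⟩, ⟨w, by simp, hw⟩]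
    obtain ⟨x, hx, hPx⟩ := lift P hPt
    obtain ⟨y, hy, hQy⟩ := lift Q hQt
    exact (key x hx y hy).of_pt_eq (hPx.symm.trans hPp) (hQy.symm.trans hQq)

/-- The empty set, the sets of one point, and the lines. -/
def IsSmall (C : Set (FourElementSubalgebra A)) : Prop :=
  C = ∅ ∨ (∃ P, C = {P}) ∨ C ∈ (orthogeometry A).lines

theorem IsSmall.exists_triad {C : Set (FourElementSubalgebra A)} (h : IsSmall C) :
    ∃ a b e : A, IsTriad a b e ∧ ∀ P ∈ C, P.1 ⊆ tri a b e := by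
  rcases h with rfl | ⟨P, rfl⟩ | h
  · exact ⟨_, _, _, isTriad_bot ⊥, fun P hP => hP.elim⟩
  · obtain ⟨a, -, hP⟩ := P.exists_pt
    refine ⟨_, _, _, isTriad_bot a, ?_⟩
    rintro Q rfl
    rw [tri_bot, hP]
  · obtain ⟨a, b, c, habc, -, -, -, rfl⟩ := exists_of_mem_subalgebraLines h
    exact ⟨a, b, c, habc, fun P hP => hP⟩

/-- A triad with a zero member degenerates to one point or to none; this is why one-point sets and
the empty set accompany the lines. -/
theorem IsTriad.exists_isSmall (h : IsTriad a b e) :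
    ∃ C : Set (FourElementSubalgebra A), IsSmall C ∧ ∀ S, C ⊆ S →
      a ∈ pointsUnion S ∧ b ∈ pointsUnion S ∧ e ∈ pointsUnion S := by
  have key : ∀ {b e : A}, IsTriad ⊥ b e → ∃ C : Set (FourElementSubalgebra A), IsSmall C ∧
      ∀ S, C ⊆ S → ⊥ ∈ pointsUnion S ∧ b ∈ pointsUnion S ∧ e ∈ pointsUnion S := by
    intro b e h
    obtain rfl := isTriad_bot_iff'.1 h
    by_cases hb : pt b = pt ⊥
    · exact ⟨∅, .inl rfl, fun S _ => ⟨.inl self_mem_pt, .inl (hb ▸ self_mem_pt),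
        .inl (hb ▸ pt_compl (a := b) ▸ self_mem_pt)⟩⟩
    · exact ⟨{mkPt b hb}, .inr (.inl ⟨_, rfl⟩), fun S hS => ⟨.inl self_mem_pt,
        .inr ⟨_, hS rfl, self_mem_pt⟩, .inr ⟨_, hS rfl, by simp [mkPt, pt]⟩⟩⟩
  by_cases ha : a = ⊥
  · subst ha
    exact key h
  by_cases hb : b = ⊥
  · subst hb
    obtain ⟨C, hC, hC'⟩ := key h.rotate
    exact ⟨C, hC, fun S hS => ⟨(hC' S hS).2.2, (hC' S hS).1, (hC' S hS).2.1⟩⟩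
  by_cases he : e = ⊥
  · subst he
    obtain ⟨C, hC, hC'⟩ := key h.rotate'
    exact ⟨C, hC, fun S hS => ⟨(hC' S hS).2.1, (hC' S hS).2.2, (hC' S hS).1⟩⟩
  obtain ⟨P, Q, R, hP, hQ, hR⟩ := exists_eq_of_triad h ha hb he
  refine ⟨{P, Q, R}, .inr (.inr (h.mem_subalgebraLines hP hQ hR)), fun S hS => ⟨?_, ?_, ?_⟩⟩
  · exact .inr ⟨P, hS (by simp), hP ▸ self_mem_pt⟩
  · exact .inr ⟨Q, hS (by simp), hQ ▸ self_mem_pt⟩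
  · exact .inr ⟨R, hS (by simp), hR ▸ self_mem_pt⟩

theorem isProper_iff_isElemProper_elemMap (α : orthogeometry A ⟶ orthogeometry B) :
    OG.IsProper α ↔ IsElemProper (elemMap (OG.Hom.toFun α)) := by
  constructor
  · intro h a b e habe
    obtain ⟨C, hC, hC'⟩ := habe.exists_isSmall
    obtain ⟨S, hS, hCS, hlt⟩ := h C hC
    obtain ⟨ha, hb, he⟩ := hC' S hCS
    obtain ⟨Q, ⟨P, hP, hPQ⟩, Q', ⟨P', hP', hPQ'⟩, hne⟩ := Set.one_lt_encard_iff_nontrivial.1 hlt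
    obtain ⟨p, -, hp⟩ := FourElementSubalgebra.exists_pt P
    obtain ⟨p', -, hp'⟩ := FourElementSubalgebra.exists_pt P'
    have e1 := (eq_some_iff_elemMap hp).1 hPQ
    have e2 := (eq_some_iff_elemMap hp').1 hPQ'
    refine ⟨pointsUnion S, isBooleanSubalgebra_pointsUnion hS, ha, hb, he,
      p, .inr ⟨P, hP, hp ▸ self_mem_pt⟩, p', .inr ⟨P', hP', hp' ▸ self_mem_pt⟩, ?_, ?_, ?_⟩
    · rw [e1]
      exact FourElementSubalgebra.ne_pt_bot Q
    · rw [e2]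
      exact FourElementSubalgebra.ne_pt_bot Q'
    · rw [e1, e2]
      exact fun h => hne (FourElementSubalgebra.ext_iff.2 h)
  · intro h C hC
    obtain ⟨a, b, e, habe, hC'⟩ := IsSmall.exists_triad hC
    obtain ⟨D, hD, ha, hb, he, s, hs, t, ht, hs0, ht0, hst⟩ := h a b e habe
    refine ⟨_, hD.isBooleanSet, fun P hP => (hC' P hP).trans (hD.tri_subset ha hb he), ?_⟩
    obtain ⟨P, Q, hP, hPQ, hQ⟩ := exists_point_of_elemMap_ne hs0
    obtain ⟨P', Q', hP', hPQ', hQ'⟩ := exists_point_of_elemMap_ne ht0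
    refine Set.one_lt_encard_iff_nontrivial.2 ⟨Q, ⟨P, ?_, hPQ⟩, Q', ⟨P', ?_, hPQ'⟩, ?_⟩
    · exact hP.le.trans (hD.pt_subset hs)
    · exact hP'.le.trans (hD.pt_subset ht)
    · rintro rfl
      exact hst (hQ.trans hQ'.symm)

theorem elemMap_orthogeometryFunctor (f : A ⟶ B) :
    elemMap (OG.Hom.toFun (orthogeometryFunctor.map f)) = fun a => pt (OMP.Hom.toFun f a) :=
  elemMap_mapPoint f

theorem bijOn_isProper (A B : OMP.{u}) :
    Set.BijOn (fun f : A ⟶ B => orthogeometryFunctor.map f) {f | OMP.IsProper f}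
      {α | OG.IsProper α} := by
  refine ⟨fun f hf => ?_, fun f hf g hg hfg => ?_, fun α hα => ?_⟩
  · refine (isProper_iff_isElemProper_elemMap _).2 ?_
    rw [elemMap_orthogeometryFunctor]
    exact (isProper_iff_isElemProper f).1 hf
  · have e := elemMap_orthogeometryFunctor f
    have e' := elemMap_orthogeometryFunctor g
    have hΦ := isUnoriented_elemMap (orthogeometryFunctor.map f)
    have hfg' : orthogeometryFunctor.map f = orthogeometryFunctor.map g := hfg
    rw [← hfg'] at e'
    refine OMP.Hom.eq_of_isElemProper (Φ := elemMap (OG.Hom.toFun (orthogeometryFunctor.map f)))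
      ?_ hΦ (fun a => congrFun e a) (fun a => congrFun e' a)
    rw [e]
    exact (isProper_iff_isElemProper f).1 hf
  · have hp := (isProper_iff_isElemProper_elemMap α).1 hα
    obtain ⟨f, hf⟩ := OMP.Hom.exists_of_isElemProper hp (isUnoriented_elemMap α)
    have e : elemMap (OG.Hom.toFun α) = fun a => pt (OMP.Hom.toFun f a) := funext hf
    refine ⟨f, ?_, ?_⟩
    · refine (isProper_iff_isElemProper f).2 ?_
      rw [e] at hp
      exact hp
    · exact OG.Hom.ext (elemMap_injective ((elemMap_orthogeometryFunctor f).trans e.symm))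

end Proper

end OrthomodularPoset

/-! ### Isomorphisms of geometries, and the effect of the functor on objects. -/

namespace PreOrthogeometry

variable {G H : PreOrthogeometry.{u}}

theorem IsPlane.map {a b c d u v w : G.Point} (h : G.IsPlane a b c d u v w)
    (φ : G.Point ≃ H.Point) (hφ : ∀ l, l ∈ G.lines ↔ φ '' l ∈ H.lines) :
    H.IsPlane (φ a) (φ b) (φ c) (φ d) (φ u) (φ v) (φ w) := by
  have line : ∀ {x y z}, {x, y, z} ∈ G.lines → {φ x, φ y, φ z} ∈ H.lines := by
    intro x y z h
    have := (hφ _).1 h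
    rwa [Set.image_insert_eq, Set.image_pair] at this
  have pull : ∀ {l x y}, l ∈ H.lines → φ x ∈ l → φ y ∈ l → ∃ m ∈ G.lines, x ∈ m ∧ y ∈ m := by
    intro l x y hl hx hy
    refine ⟨φ.symm '' l, (hφ _).2 ?_, ⟨_, hx, by simp⟩, ⟨_, hy, by simp⟩⟩
    rwa [← Set.image_comp, φ.self_comp_symm, Set.image_id]
  obtain ⟨-, -, -, -, ⟨uv, uw⟩, vw⟩ := h.nodup
  obtain ⟨l1, l2, l3, l4, l5, l6⟩ := h.lines
  refine isPlane_of_lines (line l1) (line l2) (line l3) (line l4) (line l5) (line l6)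
    (φ.injective.ne uv) (φ.injective.ne uw) (φ.injective.ne vw) ?_ ?_ ?_
  · intro l hl h1 h2
    obtain ⟨m, hm, h3⟩ := pull hl h1 h2
    exact (h.not_mem hm).1 h3
  · intro l hl h1 h2
    obtain ⟨m, hm, h3⟩ := pull hl h1 h2
    exact (h.not_mem hm).2.1 h3
  · intro l hl h1 h2
    obtain ⟨m, hm, h3⟩ := pull hl h1 h2
    exact (h.not_mem hm).2.2 h3

theorem mem_lines_symm {φ : G.Point ≃ H.Point} (hφ : ∀ l, l ∈ G.lines ↔ φ '' l ∈ H.lines)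
    (l : Set H.Point) : l ∈ H.lines ↔ φ.symm '' l ∈ G.lines := by
  rw [hφ, ← Set.image_comp, φ.self_comp_symm, Set.image_id]

end PreOrthogeometry

namespace OG

variable {G H : OG.{u}}

/-- The morphism given by a bijection of the points that preserves and reflects lines. -/
def Hom.ofEquiv (φ : G.Point ≃ H.Point) (hφ : ∀ l, l ∈ G.lines ↔ φ '' l ∈ H.lines) : Hom G H where
  toFun p := some (φ p)
  map_none _ _ _ _ h := by simp at h
  map_some := by
    rintro p q r _ _ _ h ⟨⟩ ⟨⟩ ⟨⟩
    have := (hφ _).1 h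
    rwa [Set.image_insert_eq, Set.image_pair] at this
  map_plane := by
    rintro a b c d u v w _ _ _ _ h ⟨⟩ ⟨⟩ ⟨⟩ ⟨⟩
    exact ⟨_, _, _, rfl, rfl, rfl, h.map φ hφ⟩
  reflect_plane := by
    rintro p q r s t _ _ _ _ _ v' w' _ _ ⟨⟩ ⟨⟩ ⟨⟩ ⟨⟩ ⟨⟩ h
    have := h.map φ.symm (PreOrthogeometry.mem_lines_symm hφ)
    simp only [Equiv.symm_apply_apply] at this
    exact ⟨_, _, this⟩

/-- The isomorphism given by a bijection of the points that preserves and reflects lines. -/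
def isoOfEquiv (φ : G.Point ≃ H.Point) (hφ : ∀ l, l ∈ G.lines ↔ φ '' l ∈ H.lines) : G ≅ H where
  hom := Hom.ofEquiv φ hφ
  inv := Hom.ofEquiv φ.symm (PreOrthogeometry.mem_lines_symm hφ)
  hom_inv_id := Hom.ext (funext fun p => congrArg some (φ.symm_apply_apply p))
  inv_hom_id := Hom.ext (funext fun p => congrArg some (φ.apply_symm_apply p))

theorem toFun_hom_eq_some_iff (i : G ≅ H) (p : G.Point) (q : H.Point) :
    Hom.toFun i.hom p = some q ↔ Hom.toFun i.inv q = some p := by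
  have key : ∀ {G H : OG.{u}} (i : G ≅ H) (p : G.Point) (q : H.Point),
      Hom.toFun i.hom p = some q → Hom.toFun i.inv q = some p := by
    intro G H i p q h
    have h1 : (Hom.toFun i.hom p).bind (Hom.toFun i.inv) = some p :=
      congrFun (congrArg Hom.toFun i.hom_inv_id) p
    rw [h] at h1
    exact h1
  exact ⟨key i p q, key i.symm q p⟩

theorem toFun_hom_ne_none (i : G ≅ H) (p : G.Point) : Hom.toFun i.hom p ≠ none := by
  intro h
  have h1 : (Hom.toFun i.hom p).bind (Hom.toFun i.inv) = some p :=
    congrFun (congrArg Hom.toFun i.hom_inv_id) p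
  rw [h] at h1
  cases h1

end OG

namespace OrthomodularPoset

variable {A B : OMP.{u}}

theorem orthogeometryFunctor_essSurj : (orthogeometryFunctor.{u}).EssSurj where
  mem_essImage G := by
    obtain ⟨A, ⟨ρ⟩⟩ := G.representable
    exact ⟨A, ⟨(OG.isoOfEquiv (G := G) (H := orthogeometry A) ρ.toEquiv ρ.mem_lines_iff).symm⟩⟩

theorem elemMap_hom_eq_pt_iff (i : orthogeometry A ≅ orthogeometry B) (a : A) (y : B) :
    elemMap (OG.Hom.toFun i.hom) a = pt y ↔ elemMap (OG.Hom.toFun i.inv) y = pt a := by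
  have key : ∀ {A B : OMP.{u}} (i : orthogeometry A ≅ orthogeometry B) (a : A) (y : B),
      elemMap (OG.Hom.toFun i.hom) a = pt y → elemMap (OG.Hom.toFun i.inv) y = pt a := by
    intro A B i a y h
    by_cases hy : pt y = pt ⊥
    · have ha : pt a = pt ⊥ := by
        by_contra ha
        have hP : (mkPt a ha).1 = pt a := rfl
        exact OG.toFun_hom_ne_none i (mkPt a ha) ((eq_none_iff_elemMap hP).2 (h.trans hy))
      rw [elemMap_of_pt_eq_bot hy, ha]
    · obtain ⟨P, Q, hP, hPQ, hQ⟩ := exists_point_of_elemMap_ne (h.symm ▸ hy)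
      have := (OG.toFun_hom_eq_some_iff i P Q).1 hPQ
      rw [(eq_some_iff_elemMap (hQ.symm.trans h)).1 this, hP]
  exact ⟨key i a y, key i.symm y a⟩

/-- As `Ψ` inverts `Φ`, only 0 and 1 are null, and triads containing one of them are preserved
trivially. So any orientation works; the nontrivial q is what fixes its value at 0. -/
theorem nonempty_iso_of_isUnoriented {Φ : A → Set B} {Ψ : B → Set A} (hΦ : IsUnoriented Φ)
    (hΨ : IsUnoriented Ψ) (h : ∀ a y, Φ a = pt y ↔ Ψ y = pt a) {q : A} (hq : pt q ≠ pt ⊥) :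
    Nonempty (A ≅ B) := by
  have hnull : ∀ {a}, Φ a = pt ⊥ → pt a = pt ⊥ := fun {a} ha => by
    rw [← (h a ⊥).1 ha, hΨ.bot]
  have hqΦ : Φ q ≠ pt ⊥ := fun e => hq (hnull e)
  have hA : (⊥ : A) ≠ ⊤ := fun e => by
    have : q = ⊥ := by rw [← le_bot_iff, e]; exact le_top
    exact hq (by rw [this])
  obtain ⟨f, hf⟩ := hΦ.exists_isOrientation hA
  have hB : (⊥ : B) ≠ ⊤ := fun e => by
    have : f q = ⊥ := by rw [← le_bot_iff, e]; exact le_top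
    exact hqΦ (by rw [hf.eq_pt, this])
  have f0 := hf.map_bot hqΦ hΦ
  have f1 : f ⊤ = ⊤ := by rw [← compl_bot', hf.compl, f0, compl_bot']
  have htri : ∀ a b c, IsTriad a b c → IsTriad (f a) (f b) (f c) := by
    intro a b c habc
    refine hf.map_isTriad hΦ (fun {a b c} habc ha => ?_) habc
    rcases pt_eq_bot_iff.1 (hnull ha) with rfl | rfl
    · rw [f0, isTriad_bot_iff', ← hf.compl, isTriad_bot_iff'.1 habc]
    · obtain ⟨rfl, rfl⟩ := habc.eq_bot_of_eq_top rfl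
      rw [f0, f1, isTriad_bot_iff, compl_top']
  have hinj : Function.Injective f := by
    intro a b hab
    have h1 := (h a (f a)).1 (hf.eq_pt a)
    have h2 := (h b (f b)).1 (hf.eq_pt b)
    rw [hab, h2] at h1
    rcases pt_eq_iff.1 h1 with rfl | rfl
    · rfl
    · rw [hf.compl] at hab
      exact absurd hab (ne_compl_self hB)
  have hsurj : Function.Surjective f := by
    intro y
    obtain ⟨a, ha⟩ := hΨ.exists_pt y
    have h1 := (h a y).2 ha
    rw [hf.eq_pt] at h1
    rcases pt_eq_iff.1 h1 with h1 | h1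
    · exact ⟨a, h1⟩
    · exact ⟨aᶜ, by rw [hf.compl, h1, compl_compl']⟩
  have hrefl : ∀ {a b c}, IsTriad (f a) (f b) (f c) → IsTriad a b c := by
    have key : ∀ {a b c}, IsTriad (f a) (f b) (f c) → f a = ⊥ → IsTriad a b c := by
      intro a b c habc ha
      have : a = ⊥ := hinj (ha.trans f0.symm)
      subst this
      rw [f0, isTriad_bot_iff', ← hf.compl] at habc
      exact isTriad_bot_iff'.2 (hinj habc)
    intro a b c habc
    by_cases ha : f a = ⊥
    · exact key habc ha
    by_cases hb : f b = ⊥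
    · exact (key habc.rotate hb).rotate'
    by_cases hc : f c = ⊥
    · exact (key habc.rotate' hc).rotate
    have hne : ∀ {a b c}, IsTriad (f a) (f b) (f c) → f a ≠ ⊥ → f b ≠ ⊥ →
        Ψ (f a) ≠ pt ⊥ := by
      intro a b c habc ha hb h0
      have := (h _ _).2 h0
      rw [hΦ.bot] at this
      exact habc.pt_ne_pt_bot ha hb this.symm
    -- `Ψ` returns some triad over the original points. Its image under f has the same points as the
    -- given triad, hence equals it, and injectivity of f identifies the two triads in A.
    obtain ⟨a', b', c', t, h1, h2, h3⟩ := hΨ.triad habc (hne habc ha hb) (hne habc.rotate hb hc)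
      (hne habc.rotate' hc ha)
    have e1 := (h _ _).2 h1
    have e2 := (h _ _).2 h2
    rw [hf.eq_pt] at e1 e2
    obtain ⟨h4, h5, h6⟩ := habc.eq_of_pt_eq (htri _ _ _ t) ha hb hc e1.symm e2.symm
    rwa [hinj h4, hinj h5, hinj h6]
  obtain ⟨g, hgf, hfg⟩ := Function.bijective_iff_has_inverse.1 ⟨hinj, hsurj⟩
  refine ⟨⟨OMP.Hom.ofIsTriad f f0 hf.compl htri, OMP.Hom.ofIsTriad g ?_ (fun y => hinj ?_)
    (fun x y z hxyz => hrefl ?_), OMP.Hom.ext (funext hgf), OMP.Hom.ext (funext hfg)⟩⟩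
  · rw [← f0, hgf]
  · rw [hfg, hf.compl, hfg]
  · rwa [hfg, hfg, hfg]

theorem card_le_two_iff : ENat.card A ≤ 2 ↔ ∀ a : A, pt a = pt ⊥ := by
  rw [← Set.encard_univ]
  constructor
  · intro h a
    by_contra ha
    have := (Set.encard_le_encard (Set.subset_univ (pt a))).trans h
    rw [pt_encard ha] at this
    norm_num at this
  · intro h
    have hsub : (Set.univ : Set A) ⊆ {⊥, ⊤} := fun a _ => pt_eq_bot_iff.1 (h a)
    refine (Set.encard_le_encard hsub).trans ((Set.encard_insert_le _ _).trans ?_)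
    rw [Set.encard_singleton]
    norm_num

theorem isEmpty_of_card_le_two (h : ENat.card A ≤ 2) : IsEmpty (FourElementSubalgebra A) :=
  ⟨fun P => by
    obtain ⟨a, ha, -⟩ := P.exists_pt
    exact ha (card_le_two_iff.1 h a)⟩

theorem nonempty_iso_orthogeometry_iff (A B : OMP.{u}) :
    Nonempty (orthogeometryFunctor.obj A ≅ orthogeometryFunctor.obj B) ↔
      Nonempty (A ≅ B) ∨ (ENat.card A ≤ 2 ∧ ENat.card B ≤ 2) := by
  constructor
  · rintro ⟨i⟩
    have hi := elemMap_hom_eq_pt_iff (A := A) (B := B) i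
    by_cases hA : ∃ a : A, pt a ≠ pt ⊥
    · obtain ⟨q, hq⟩ := hA
      exact .inl (nonempty_iso_of_isUnoriented (isUnoriented_elemMap (A := A) (B := B) i.hom)
        (isUnoriented_elemMap (A := B) (B := A) i.inv) hi hq)
    · push Not at hA
      refine .inr ⟨card_le_two_iff.2 hA, card_le_two_iff.2 fun y => ?_⟩
      obtain ⟨a, ha⟩ := (isUnoriented_elemMap (A := B) (B := A) i.inv).exists_pt y
      have h1 := (hi a y).2 ha
      rw [← h1]
      exact elemMap_of_pt_eq_bot (hA a)
  · rintro (⟨⟨i⟩⟩ | ⟨hA, hB⟩)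
    · exact ⟨orthogeometryFunctor.mapIso i⟩
    -- Both geometries are empty.
    · have := isEmpty_of_card_le_two hA
      have := isEmpty_of_card_le_two hB
      refine ⟨OG.isoOfEquiv (G := orthogeometry A) (H := orthogeometry B)
        (Equiv.equivOfIsEmpty (FourElementSubalgebra A) (FourElementSubalgebra B)) fun l => ?_⟩
      refine iff_of_false (fun hl => ?_) (fun hl => ?_)
      · obtain ⟨a, b, c, h, ha, hb, -⟩ := exists_of_mem_subalgebraLines hl
        exact isEmptyElim (mkPt a (h.pt_ne_pt_bot ha hb))
      · obtain ⟨a, b, c, h, ha, hb, -⟩ := exists_of_mem_subalgebraLines hl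
        exact isEmptyElim (mkPt a (h.pt_ne_pt_bot ha hb))

end OrthomodularPoset

theorem mainTheorem9 :
    ∃ (G : OMP.{u} ⥤ OG.{u})
      (e : ∀ A : OMP.{u}, (G.obj A).toPreOrthogeometry.Representation A),
      -- on morphisms, `G` sends a 4-element Boolean subalgebra to its image whenever that is again
      -- a 4-element Boolean subalgebra, and is undefined there otherwise
      (∀ (A B : OMP.{u}) (f : A ⟶ B) (p : (G.obj A).Point) (q : (G.obj B).Point),
        OG.Hom.toFun (G.map f) p = some q ↔
          ((e B).toEquiv q).1 = OMP.Hom.toFun f '' ((e A).toEquiv p).1) ∧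
      -- essentially surjective on objects
      G.EssSurj ∧
      -- injective on (isomorphism classes of) objects, with the exception of the orthomodular
      -- posets with one or two elements
      (∀ A B : OMP.{u}, Nonempty (G.obj A ≅ G.obj B) ↔
        Nonempty (A ≅ B) ∨ (ENat.card A ≤ 2 ∧ ENat.card B ≤ 2)) ∧
      -- full and faithful with respect to proper morphisms
      (∀ A B : OMP.{u}, Set.BijOn (fun f : A ⟶ B => G.map f)
        {f | OMP.IsProper f} {α | OG.IsProper α}) :=
  ⟨OrthomodularPoset.orthogeometryFunctor, OrthomodularPoset.subalgebraRepresentation,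
    fun _ _ _ _ _ => OrthomodularPoset.mapPoint_eq_some_iff,
    OrthomodularPoset.orthogeometryFunctor_essSurj,
    OrthomodularPoset.nonempty_iso_orthogeometry_iff, OrthomodularPoset.bijOn_isProper⟩
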